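/- Let $\ell_1,\ell_2,\kappa,\beta,\rho,\mu>0$, $\chi,\gamma\in\mathbb R$ with $\chi_1:=\chi-\gamma^2\beta>0$, $0<\alpha<1$, $\eta\ge 0$, and put $\mathfrak C=\frac{\sin(\alpha\pi)}{\pi}$ and $\mu(\xi)=|\xi|^{\frac{2\alpha-1}{2}}$ for $\xi\in\mathbb R$. All function spaces are spaces of complex-valued functions. Let $H^1_R(0,\ell_2)=\{u\in H^1(0,\ell_2):u(\ell_2)=0\}$ and $H^1_L(-\ell_1,0)=\{u\in H^1(-\ell_1,0):u(-\ell_1)=0\}$, and let $$\mathcal H=L^2(-\ell_1,0)\times H^1_R(0,\ell_2)\times L^2(0,\ell_2)\times H^1_R(0,\ell_2)\times L^2(0,\ell_2)\times L^2(\mathbb R;L^2(0,\ell_2)),$$ with elements $\mathbb U=(z,v,V,p,P,\varphi)$, be equipped with the inner product whose norm is $$\|\mathbb U\|_{\mathcal H}^2=\|z\|^2_{L^2(-\ell_1,0)}+\chi_1\|v_x\|^2_{L^2(0,\ell_2)}+\rho\|V\|^2_{L^2(0,\ell_2)}+\mu\|P\|^2_{L^2(0,\ell_2)}+\beta\|\gamma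 v_x-p_x\|^2_{L^2(0,\ell_2)}+\mathfrak C\|\varphi\|^2_{L^2(\mathbb R;L^2(0,\ell_2))}.$$ Let $\mathcal A:\mathcal D(\mathcal A)\subset\mathcal H\to\mathcal H$ be the linear operator $$\mathcal A\begin{pmatrix}z\\v\\V\\p\\P\\\varphi\end{pmatrix}=\begin{pmatrix}\kappa z_{xx}\\V\\\frac1\rho\left(\chi v_{xx}-\gamma\beta p_{xx}-\mathfrak C\int_{\mathbb R}\mu(\xi)\varphi(\xi)\,d\xi\right)\\P\\\frac1\mu\left(\beta p_{xx}-\gamma\beta v_{xx}\right)\\-(|\xi|^2+\eta)\varphi(\xi)+\mu(\xi)V\end{pmatrix}$$ whose domain $\mathcal D(\mathcal A)$ consists of all $(z,v,V,p,P,\varphi)\in\mathcal H$ such that $z\in H^1_L(-\ell_1,0)\cap H^2(-\ell_1,0)$; $v,p\in H^1_R(0,\ell_2)\cap H^2(0,\ell_2)$; $V,P\in H^1_R(0,\ell_2)$; $|\xi|\varphi\in L^2(\mathbb R;L^2(0,\ell_2))$; $-(|\xi|^2+\eta)\varphi+\mu(\xi)V\in L^2(\mathbb R;L^2(0,\ell_2))$;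 and the transmission conditions $$z(0)=V(0),\qquad \chi v_x(0)-\gamma\beta p_x(0)=\kappa z_x(0),\qquad \beta p_x(0)=\gamma\beta v_x(0)$$ hold. Then $\mathcal A$ is the infinitesimal generator of a strongly continuous semigroup of contractions $\{\mathcal S_{\mathcal A}(t)\}_{t\ge0}$ on $\mathcal H$: $\mathcal S_{\mathcal A}(0)=I$, $\mathcal S_{\mathcal A}(s+t)=\mathcal S_{\mathcal A}(s)\mathcal S_{\mathcal A}(t)$, $\mathcal S_{\mathcal A}(t)\mathbb U\to\mathbb U$ as $t\to0^+$ for every $\mathbb U\in\mathcal H$, $\|\mathcal S_{\mathcal A}(t)\|\le1$ for every $t\ge 0$, and, for $\mathbb U,\mathbb F\in\mathcal H$, one has $\mathbb U\in\mathcal D(\mathcal A)$ and $\mathcal A\mathbb U=\mathbb F$ if and only if $\frac{\mathcal S_{\mathcal A}(t)\mathbb U-\mathbb U}{t}\to\mathbb F$ in $\mathcal H$ as $t\to0^+$. -/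

import Mathlib

open MeasureTheory Set Filter Topology
open scoped ContDiff NNReal ENNReal

noncomputable section

/-- `g` is a real test function on the open interval `(a, b)`: smooth, with compact support contained
in `(a, b)`. -/
structure IsTestFunction (a b : ℝ) (g : ℝ → ℝ) : Prop where
  contDiff : ContDiff ℝ ∞ g
  hasCompactSupport : HasCompactSupport g
  tsupport_subset : tsupport g ⊆ Ioo a b

theorem IsTestFunction.exists_Icc {a b : ℝ} {g : ℝ → ℝ} (hg : IsTestFunction a b g) (hab : a < b) :
    ∃ c d, a < c ∧ c < d ∧ d < b ∧ ∀ x, x ∉ Icc c d → g x = 0 := by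
  by_cases hne : (tsupport g).Nonempty
  · have hc : IsCompact (tsupport g) := hg.hasCompactSupport
    have h1 := hg.tsupport_subset (hc.sInf_mem hne)
    have h2 := hg.tsupport_subset (hc.sSup_mem hne)
    refine ⟨(a + sInf (tsupport g)) / 2, (b + sSup (tsupport g)) / 2, ?_, ?_, ?_, ?_⟩
    · linarith [h1.1]
    · have := csInf_le hc.bddBelow (hc.sSup_mem hne)
      linarith [h1.1, h2.2]
    · linarith [h2.2]
    · intro x hx
      by_contra h0
      have hx' : x ∈ tsupport g := subset_tsupport g h0
      apply hx
      have := csInf_le hc.bddBelow hx'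
      have := le_csSup hc.bddAbove hx'
      constructor <;> linarith [h1.1, h2.2]
  · rw [not_nonempty_iff_eq_empty, tsupport_eq_empty_iff] at hne
    refine ⟨a + (b - a) / 3, a + 2 * (b - a) / 3, by linarith, by linarith, by linarith, ?_⟩
    intro x _; rw [hne]; rfl

theorem isTestFunction_of_Icc {a b c d : ℝ} {g : ℝ → ℝ} (hg : ContDiff ℝ ∞ g)
    (hac : a < c) (hdb : d < b) (h : ∀ x, x ∉ Icc c d → g x = 0) : IsTestFunction a b g := by
  have hs : tsupport g ⊆ Icc c d :=
    closure_minimal (fun x hx => by by_contra h'; exact hx (h x h')) isClosed_Icc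
  exact ⟨hg, HasCompactSupport.of_support_subset_isCompact isCompact_Icc
    ((subset_tsupport g).trans hs), hs.trans (Icc_subset_Ioo hac hdb)⟩

theorem IsTestFunction.hasDerivAt {a b : ℝ} {g : ℝ → ℝ} (hg : IsTestFunction a b g) (x : ℝ) :
    HasDerivAt g (deriv g x) x :=
  ((hg.contDiff.differentiable (by simp)) x).hasDerivAt

theorem IsTestFunction.continuous_deriv {a b : ℝ} {g : ℝ → ℝ} (hg : IsTestFunction a b g) :
    Continuous (deriv g) := hg.contDiff.continuous_deriv (by simp)

theorem IsTestFunction.eq_zero_right {a b : ℝ} {g : ℝ → ℝ} (hg : IsTestFunction a b g) :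
    g b = 0 := by
  by_contra h
  exact lt_irrefl b (hg.tsupport_subset (subset_tsupport g h)).2

/-- The lemma of du Bois-Reymond. -/
theorem ae_eq_const_of_integral_deriv_smul_eq_zero {a b : ℝ} (hab : a < b) {f : ℝ → ℂ}
    (hf : IntegrableOn f (Ioo a b))
    (h : ∀ g, IsTestFunction a b g → ∫ x in Ioo a b, deriv g x • f x = 0) :
    ∃ c : ℂ, f =ᵐ[volume.restrict (Ioo a b)] fun _ => c := by
  classical
  let B : ContDiffBump ((a + b) / 2) := ⟨(b - a) / 8, (b - a) / 4, by linarith, by linarith⟩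
  set ψ : ℝ → ℝ := B.normed volume with hψ
  have hψc : ContDiff ℝ ∞ ψ := B.contDiff_normed
  have hψi : ∫ x, ψ x = 1 := B.integral_normed
  have hψ0 : ∀ x, x ∉ Icc (a + (b - a) / 4) (b - (b - a) / 4) → ψ x = 0 := by
    intro x hx
    by_contra h0
    have : x ∈ tsupport ψ := subset_tsupport _ h0
    rw [hψ, B.tsupport_normed_eq, Real.closedBall_eq_Icc] at this
    apply hx
    change x ∈ Icc ((a + b) / 2 - (b - a) / 4) ((a + b) / 2 + (b - a) / 4) at this
    constructor <;> linarith [this.1, this.2]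
  have hψt : IsTestFunction a b ψ := isTestFunction_of_Icc hψc (by linarith) (by linarith) hψ0
  have hbd : ∀ g, IsTestFunction a b g → IntegrableOn (fun x => g x • f x) (Ioo a b) := by
    intro g hg
    obtain ⟨C, hC⟩ := hg.hasCompactSupport.exists_bound_of_continuous hg.contDiff.continuous
    exact hf.bdd_smul C hg.contDiff.continuous.aestronglyMeasurable (Eventually.of_forall hC)
  refine ⟨∫ x in Ioo a b, ψ x • f x, ?_⟩
  set c := ∫ x in Ioo a b, ψ x • f x with hc
  have key := isOpen_Ioo.ae_eq_zero_of_integral_contDiff_smul_eq_zero (μ := volume) (U := Ioo a b)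
    (f := fun x => f x - c) ((hf.sub (integrableOn_const (by simp))).locallyIntegrableOn) ?_
  · filter_upwards [ae_restrict_of_ae key, ae_restrict_mem measurableSet_Ioo] with x hx hx'
    exact sub_eq_zero.1 (hx hx')
  · intro g g1 g2 g3
    have hg : IsTestFunction a b g := ⟨g1, g2, g3⟩
    have hgi : Integrable g := g1.continuous.integrable_of_hasCompactSupport g2
    have hψint : Integrable ψ := hψc.continuous.integrable_of_hasCompactSupport hψt.hasCompactSupport
    set m := ∫ x, g x with hm
    obtain ⟨p, q, hap, hpq, hqb, hp⟩ := hg.exists_Icc hab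
    set p' := min p (a + (b - a) / 4)
    set q' := max q (b - (b - a) / 4)
    set r : ℝ → ℝ := fun x => g x - m * ψ x with hr
    have hrc : ContDiff ℝ ∞ r := g1.sub (contDiff_const.mul hψc)
    have hr0 : ∀ x, x ∉ Icc p' q' → r x = 0 := by
      intro x hx
      have e1 : g x = 0 := hp x fun hx' => hx ⟨(min_le_left _ _).trans hx'.1, hx'.2.trans (le_max_left _ _)⟩
      have e2 : ψ x = 0 := hψ0 x fun hx' => hx ⟨(min_le_right _ _).trans hx'.1, hx'.2.trans (le_max_right _ _)⟩
      simp [hr, e1, e2]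
    have hri : ∫ x, r x = 0 := by
      rw [hr, integral_sub hgi (hψint.const_mul _), integral_const_mul, hψi, mul_one, sub_self]
    let θ : ℝ → ℝ := fun x => ∫ t in a..x, r t
    have hθd : ∀ x, HasDerivAt θ (r x) x := fun x => hrc.continuous.integral_hasStrictDerivAt a x |>.hasDerivAt
    have hθ' : deriv θ = r := funext fun x => (hθd x).deriv
    have hθc : ContDiff ℝ ∞ θ := by
      rw [contDiff_infty_iff_deriv, hθ']
      exact ⟨fun x => (hθd x).differentiableAt, hrc⟩
    have hap' : a < p' := lt_min hap (by linarith)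
    have hθ0 : ∀ x, x ∉ Icc p' q' → θ x = 0 := by
      intro x hx
      rw [mem_Icc, not_and_or, not_le, not_le] at hx
      rcases hx with hx | hx
      · apply intervalIntegral.integral_zero_ae
        refine Eventually.of_forall fun t ht => hr0 t fun h => ?_
        have := (uIoc_subset_uIcc ht).2
        exact absurd (h.1.trans this) (not_le.2 (max_lt hap' hx))
      · change ∫ t in a..x, r t = 0
        rw [intervalIntegral.integral_eq_integral_of_support_subset, hri]
        intro t ht
        have : t ∈ Icc p' q' := by by_contra h'; exact ht (hr0 t h')
        exact ⟨hap'.trans_le this.1, this.2.trans hx.le⟩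
    have hθt : IsTestFunction a b θ := isTestFunction_of_Icc hθc (lt_min hap (by linarith))
      (max_lt hqb (by linarith)) hθ0
    have := h θ hθt
    rw [hθ'] at this
    have hz : ∫ x in Ioo a b, g x • (f x - c) = 0 := by
      have e : ∀ x, r x • f x = g x • f x - m • (ψ x • f x) := by
        intro x; simp only [hr, sub_smul, smul_smul]
      simp_rw [e] at this
      have i2 : IntegrableOn (fun x => m • (ψ x • f x)) (Ioo a b) := (hbd ψ hψt).smul m
      rw [integral_sub (hbd g hg) i2, integral_smul, ← hc] at this
      simp_rw [smul_sub]
      rw [integral_sub (hbd g hg) (hgi.integrableOn.smul_const c), integral_smul_const]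
      rw [setIntegral_eq_integral_of_forall_compl_eq_zero (f := g), ← hm, this]
      intro x hx
      exact hp x fun hx' => hx (Icc_subset_Ioo hap hqb hx')
    rw [← hz, setIntegral_eq_integral_of_forall_compl_eq_zero]
    intro x hx
    rw [hp x fun hx' => hx (Icc_subset_Ioo hap hqb hx'), zero_smul]

/-- A primitive of `w ∈ L¹(a, b)` has weak derivative `w`. -/
theorem integral_deriv_smul_primitive {a b : ℝ} {w : ℝ → ℂ}
    (hw : IntegrableOn w (Ioo a b)) {g : ℝ → ℝ} (hg : IsTestFunction a b g) :
    ∫ x in Ioo a b, deriv g x • (∫ t in a..x, w t) = - ∫ x in Ioo a b, g x • w x := by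
  obtain ⟨C, hC⟩ := hg.hasCompactSupport.deriv.exists_bound_of_continuous hg.continuous_deriv
  have hint : Integrable (fun z : ℝ × ℝ => deriv g z.1 • w z.2)
      ((volume.restrict (Ioo a b)).prod (volume.restrict (Ioo a b))) := by
    apply Integrable.smul_prod
    · exact ((hg.continuous_deriv.integrable_of_hasCompactSupport hg.hasCompactSupport.deriv)).integrableOn
    · exact hw
  have hS : MeasurableSet {z : ℝ × ℝ | z.2 ≤ z.1} := measurableSet_le measurable_snd measurable_fst
  have hint' := hint.indicator hS
  have L : ∫ x in Ioo a b, deriv g x • (∫ t in a..x, w t) =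
      ∫ x in Ioo a b, ∫ t in Ioo a b,
        {z : ℝ × ℝ | z.2 ≤ z.1}.indicator (fun z : ℝ × ℝ => deriv g z.1 • w z.2) (x, t) := by
    refine setIntegral_congr_fun measurableSet_Ioo fun x hx => ?_
    have : (fun t => {z : ℝ × ℝ | z.2 ≤ z.1}.indicator (fun z : ℝ × ℝ => deriv g z.1 • w z.2) (x, t))
        = (Iic x).indicator (fun t => deriv g x • w t) := by
      ext t; simp [indicator]
    rw [this, setIntegral_indicator measurableSet_Iic, integral_smul,
      intervalIntegral.integral_of_le hx.1.le]
    congr 3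
    ext t; simp only [mem_Ioc, mem_inter_iff, mem_Ioo, mem_Iic]
    exact ⟨fun h => ⟨⟨h.1, h.2.trans_lt hx.2⟩, h.2⟩, fun h => ⟨h.1.1, h.2⟩⟩
  rw [L, integral_integral_swap (f := fun x t => {z : ℝ × ℝ | z.2 ≤ z.1}.indicator
    (fun z : ℝ × ℝ => deriv g z.1 • w z.2) (x, t)) hint', ← integral_neg]
  refine setIntegral_congr_fun measurableSet_Ioo fun t ht => ?_
  change _ = - (g t • w t)
  have : (fun x => {z : ℝ × ℝ | z.2 ≤ z.1}.indicator (fun z : ℝ × ℝ => deriv g z.1 • w z.2) (x, t))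
        = (Ici t).indicator (fun x => deriv g x • w t) := by
      ext t; simp [indicator]
  rw [this, setIntegral_indicator measurableSet_Ici, integral_smul_const, ← neg_smul]
  congr 1
  have e : Ioo a b ∩ Ici t = Ico t b := by
    ext x; simp only [mem_Ico, mem_inter_iff, mem_Ioo, mem_Ici]
    exact ⟨fun h => ⟨h.2, h.1.2⟩, fun h => ⟨⟨ht.1.trans_le h.1, h.2⟩, h.1⟩⟩
  rw [e, integral_Ico_eq_integral_Ioc, ← intervalIntegral.integral_of_le ht.2.le,
    intervalIntegral.integral_eq_sub_of_hasDerivAt (fun x _ => hg.hasDerivAt x)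
      (hg.continuous_deriv.intervalIntegrable _ _), hg.eq_zero_right, zero_sub]


/-- The complex Hilbert space `L²(a, b)`. -/
abbrev IntervalL2 (a b : ℝ) : Type := Lp ℂ 2 (volume.restrict (Ioo a b))

theorem IntervalL2.integrableOn {a b : ℝ} (u : IntervalL2 a b) : IntegrableOn u (Ioo a b) :=
  (Lp.memLp u).integrable (by norm_num)

theorem IsTestFunction.integrableOn_smul {a b : ℝ} {g : ℝ → ℝ} (hg : IsTestFunction a b g)
    {f : ℝ → ℂ} (hf : IntegrableOn f (Ioo a b)) : IntegrableOn (fun x => g x • f x) (Ioo a b) := by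
  obtain ⟨C, hC⟩ := hg.hasCompactSupport.exists_bound_of_continuous hg.contDiff.continuous
  exact hf.bdd_smul C hg.contDiff.continuous.aestronglyMeasurable (Eventually.of_forall hC)

theorem IsTestFunction.integrableOn_deriv_smul {a b : ℝ} {g : ℝ → ℝ} (hg : IsTestFunction a b g)
    {f : ℝ → ℂ} (hf : IntegrableOn f (Ioo a b)) :
    IntegrableOn (fun x => deriv g x • f x) (Ioo a b) := by
  obtain ⟨C, hC⟩ := hg.hasCompactSupport.deriv.exists_bound_of_continuous hg.continuous_deriv
  exact hf.bdd_smul C hg.continuous_deriv.aestronglyMeasurable (Eventually.of_forall hC)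

/-- `w ∈ L²(a, b)` is the weak derivative of `u ∈ L²(a, b)`. -/
def HasWeakDeriv {a b : ℝ} (u w : IntervalL2 a b) : Prop :=
  ∀ g : ℝ → ℝ, IsTestFunction a b g →
    ∫ x in Ioo a b, deriv g x • u x = - ∫ x in Ioo a b, g x • w x

theorem HasWeakDeriv.add {a b : ℝ} {u u' w w' : IntervalL2 a b} (h : HasWeakDeriv u w)
    (h' : HasWeakDeriv u' w') : HasWeakDeriv (u + u') (w + w') := by
  intro g hg
  have e1 : ∫ x in Ioo a b, deriv g x • (u + u' : IntervalL2 a b) x =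
      ∫ x in Ioo a b, (deriv g x • u x + deriv g x • u' x) := by
    apply integral_congr_ae
    filter_upwards [Lp.coeFn_add u u'] with x hx
    rw [hx, Pi.add_apply, smul_add]
  have e2 : ∫ x in Ioo a b, g x • (w + w' : IntervalL2 a b) x =
      ∫ x in Ioo a b, (g x • w x + g x • w' x) := by
    apply integral_congr_ae
    filter_upwards [Lp.coeFn_add w w'] with x hx
    rw [hx, Pi.add_apply, smul_add]
  rw [e1, e2, integral_add (hg.integrableOn_deriv_smul u.integrableOn)
    (hg.integrableOn_deriv_smul u'.integrableOn), integral_add (hg.integrableOn_smul w.integrableOn)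
    (hg.integrableOn_smul w'.integrableOn), h g hg, h' g hg, neg_add]

theorem HasWeakDeriv.smul {a b : ℝ} {u w : IntervalL2 a b} (c : ℂ) (h : HasWeakDeriv u w) :
    HasWeakDeriv (c • u) (c • w) := by
  intro g hg
  have e1 : ∫ x in Ioo a b, deriv g x • (c • u : IntervalL2 a b) x =
      ∫ x in Ioo a b, c • (deriv g x • u x) := by
    apply integral_congr_ae
    filter_upwards [Lp.coeFn_smul c u] with x hx
    rw [hx, Pi.smul_apply, smul_comm]
  have e2 : ∫ x in Ioo a b, g x • (c • w : IntervalL2 a b) x =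
      ∫ x in Ioo a b, c • (g x • w x) := by
    apply integral_congr_ae
    filter_upwards [Lp.coeFn_smul c w] with x hx
    rw [hx, Pi.smul_apply, smul_comm]
  rw [e1, e2, integral_smul, integral_smul, h g hg, smul_neg]

theorem HasWeakDeriv.zero (a b : ℝ) : HasWeakDeriv (0 : IntervalL2 a b) 0 := by
  simpa using HasWeakDeriv.smul (0 : ℂ) (u := (0 : IntervalL2 a b)) (w := 0) (by
    intro g hg
    have e (f : ℝ → ℝ) : ∫ x in Ioo a b, f x • (0 : IntervalL2 a b) x = 0 := by
      rw [← integral_zero ℝ ℂ]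
      apply integral_congr_ae
      filter_upwards [Lp.coeFn_zero ℂ 2 (volume.restrict (Ioo a b))] with x hx
      rw [hx, Pi.zero_apply, smul_zero]
    rw [e, e, neg_zero])

theorem HasWeakDeriv.unique {a b : ℝ} {u w w' : IntervalL2 a b} (h : HasWeakDeriv u w)
    (h' : HasWeakDeriv u w') : w = w' := by
  have key := isOpen_Ioo.ae_eq_zero_of_integral_contDiff_smul_eq_zero (μ := volume) (U := Ioo a b)
    (f := fun x => w x - w' x)
    ((w.integrableOn.sub w'.integrableOn).locallyIntegrableOn) ?_
  · apply Lp.ext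
    filter_upwards [ae_restrict_of_ae key, ae_restrict_mem measurableSet_Ioo] with x hx hx'
    exact sub_eq_zero.1 (hx hx')
  · intro g g1 g2 g3
    have hg : IsTestFunction a b g := ⟨g1, g2, g3⟩
    rw [← setIntegral_eq_integral_of_forall_compl_eq_zero (s := Ioo a b)]
    · simp_rw [smul_sub]
      rw [integral_sub (hg.integrableOn_smul w.integrableOn) (hg.integrableOn_smul w'.integrableOn),
        ← neg_inj, neg_sub', ← h g hg, ← h' g hg]
      simp
    · intro x hx
      have : g x = 0 := by
        by_contra h0
        exact hx (g3 (subset_tsupport g h0))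
      rw [this, zero_smul]

/-- `f` is a representative of the class `u ∈ L²(a, b)` that is continuous on `[a, b]`. -/
def IsContinuousRep {a b : ℝ} (u : IntervalL2 a b) (f : ℝ → ℂ) : Prop :=
  ContinuousOn f (Icc a b) ∧ u =ᵐ[volume.restrict (Ioo a b)] f

theorem IsContinuousRep.eqOn {a b : ℝ} (hab : a < b) {u : IntervalL2 a b} {f f' : ℝ → ℂ}
    (h : IsContinuousRep u f) (h' : IsContinuousRep u f') : EqOn f f' (Icc a b) := by
  refine Measure.eqOn_Icc_of_ae_eq volume hab.ne ?_ h.1 h'.1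
  rw [restrict_Ioo_eq_restrict_Icc.symm]
  exact h.2.symm.trans h'.2

theorem IsContinuousRep.add {a b : ℝ} {u u' : IntervalL2 a b} {f f' : ℝ → ℂ}
    (h : IsContinuousRep u f) (h' : IsContinuousRep u' f') : IsContinuousRep (u + u') (f + f') :=
  ⟨h.1.add h'.1, (Lp.coeFn_add u u').trans (h.2.add h'.2)⟩

theorem IsContinuousRep.smul {a b : ℝ} {u : IntervalL2 a b} {f : ℝ → ℂ} (c : ℂ)
    (h : IsContinuousRep u f) : IsContinuousRep (c • u) (c • f) :=
  ⟨h.1.const_smul c, (Lp.coeFn_smul c u).trans (h.2.const_smul c)⟩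

theorem HasWeakDeriv.exists_isContinuousRep {a b : ℝ} (hab : a < b) {u w : IntervalL2 a b}
    (h : HasWeakDeriv u w) :
    ∃ c : ℂ, IsContinuousRep u fun x => c + ∫ t in a..x, w t := by
  have hwI : IntegrableOn w (Icc a b) := by
    rw [integrableOn_Icc_iff_integrableOn_Ioo]; exact w.integrableOn
  have hcont : ContinuousOn (fun x => ∫ t in a..x, w t) (Icc a b) :=
    intervalIntegral.continuousOn_primitive_interval (by rwa [uIcc_of_le hab.le])
      |>.mono (by rw [uIcc_of_le hab.le])
  have hI : IntegrableOn (fun x => ∫ t in a..x, w t) (Ioo a b) :=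
    (hcont.integrableOn_Icc).mono_set Ioo_subset_Icc_self
  obtain ⟨c, hc⟩ := ae_eq_const_of_integral_deriv_smul_eq_zero hab
    (f := fun x => u x - ∫ t in a..x, w t) (u.integrableOn.sub hI) (by
      intro g hg
      simp_rw [smul_sub]
      rw [integral_sub (hg.integrableOn_deriv_smul u.integrableOn) (hg.integrableOn_deriv_smul hI),
        h g hg, integral_deriv_smul_primitive w.integrableOn hg, sub_self])
  refine ⟨c, continuousOn_const.add hcont, ?_⟩
  filter_upwards [hc] with x hx
  rw [← hx]; ring

/-- The Sobolev space `H¹(a, b)`: the elements of `L²(a, b)` with a weak derivative in `L²(a, b)`. -/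
def SobolevH1 (a b : ℝ) : Submodule ℂ (IntervalL2 a b) where
  carrier := {u | ∃ w, HasWeakDeriv u w}
  add_mem' := by rintro u u' ⟨w, h⟩ ⟨w', h'⟩; exact ⟨w + w', h.add h'⟩
  zero_mem' := ⟨0, .zero a b⟩
  smul_mem' := by rintro c u ⟨w, h⟩; exact ⟨c • w, h.smul c⟩

open Classical in
/-- The weak derivative `u_x ∈ L²(a, b)` of `u ∈ H¹(a, b)` (and `0` if `u ∉ H¹(a, b)`). -/
def weakDeriv {a b : ℝ} (u : IntervalL2 a b) : IntervalL2 a b :=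
  if h : ∃ w, HasWeakDeriv u w then h.choose else 0

theorem HasWeakDeriv.weakDeriv_eq {a b : ℝ} {u w : IntervalL2 a b} (h : HasWeakDeriv u w) :
    weakDeriv u = w := by
  have h' : ∃ w, HasWeakDeriv u w := ⟨w, h⟩
  rw [weakDeriv, dif_pos h']
  exact h'.choose_spec.unique h

theorem hasWeakDeriv_weakDeriv {a b : ℝ} {u : IntervalL2 a b} (h : u ∈ SobolevH1 a b) :
    HasWeakDeriv u (weakDeriv u) := by
  obtain ⟨w, hw⟩ := h
  rwa [hw.weakDeriv_eq]

theorem weakDeriv_add {a b : ℝ} {u u' : IntervalL2 a b} (h : u ∈ SobolevH1 a b)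
    (h' : u' ∈ SobolevH1 a b) : weakDeriv (u + u') = weakDeriv u + weakDeriv u' :=
  ((hasWeakDeriv_weakDeriv h).add (hasWeakDeriv_weakDeriv h')).weakDeriv_eq

theorem weakDeriv_smul {a b : ℝ} {u : IntervalL2 a b} (c : ℂ) (h : u ∈ SobolevH1 a b) :
    weakDeriv (c • u) = c • weakDeriv u :=
  ((hasWeakDeriv_weakDeriv h).smul c).weakDeriv_eq

theorem weakDeriv_zero (a b : ℝ) : weakDeriv (0 : IntervalL2 a b) = 0 :=
  (HasWeakDeriv.zero a b).weakDeriv_eq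

/-- The Sobolev space `H²(a, b)`: `u, u_x ∈ H¹(a, b)`. -/
def SobolevH2 (a b : ℝ) : Submodule ℂ (IntervalL2 a b) where
  carrier := {u | u ∈ SobolevH1 a b ∧ weakDeriv u ∈ SobolevH1 a b}
  add_mem' := by
    rintro u u' ⟨h1, h2⟩ ⟨h1', h2'⟩
    exact ⟨add_mem h1 h1', by rw [weakDeriv_add h1 h1']; exact add_mem h2 h2'⟩
  zero_mem' := ⟨zero_mem _, by rw [weakDeriv_zero]; exact zero_mem _⟩
  smul_mem' := by
    rintro c u ⟨h1, h2⟩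
    exact ⟨Submodule.smul_mem _ c h1, by rw [weakDeriv_smul c h1]; exact Submodule.smul_mem _ c h2⟩

open Classical in
/-- The value `u(x)` at a point `x ∈ [a, b]`, end points included, of the continuous representative of
`u` (every element of `H¹(a, b)` has exactly one); `0` if there is none. -/
def pointValue {a b : ℝ} (u : IntervalL2 a b) (x : ℝ) : ℂ :=
  if h : ∃ f, IsContinuousRep u f then h.choose x else 0

theorem IsContinuousRep.pointValue_eq {a b : ℝ} (hab : a < b) {u : IntervalL2 a b} {f : ℝ → ℂ}
    (h : IsContinuousRep u f) {x : ℝ} (hx : x ∈ Icc a b) : pointValue u x = f x := by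
  have h' : ∃ f, IsContinuousRep u f := ⟨f, h⟩
  rw [pointValue, dif_pos h']
  exact h'.choose_spec.eqOn hab h hx

theorem exists_isContinuousRep {a b : ℝ} (hab : a < b) {u : IntervalL2 a b}
    (h : u ∈ SobolevH1 a b) : ∃ f, IsContinuousRep u f :=
  let ⟨_, hc⟩ := (hasWeakDeriv_weakDeriv h).exists_isContinuousRep hab
  ⟨_, hc⟩

theorem pointValue_add {a b : ℝ} (hab : a < b) {u u' : IntervalL2 a b} (h : u ∈ SobolevH1 a b)
    (h' : u' ∈ SobolevH1 a b) {x : ℝ} (hx : x ∈ Icc a b) :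
    pointValue (u + u') x = pointValue u x + pointValue u' x := by
  obtain ⟨f, hf⟩ := exists_isContinuousRep hab h
  obtain ⟨f', hf'⟩ := exists_isContinuousRep hab h'
  rw [(hf.add hf').pointValue_eq hab hx, hf.pointValue_eq hab hx, hf'.pointValue_eq hab hx]
  rfl

theorem pointValue_smul {a b : ℝ} (hab : a < b) {u : IntervalL2 a b} (c : ℂ)
    (h : u ∈ SobolevH1 a b) {x : ℝ} (hx : x ∈ Icc a b) :
    pointValue (c • u) x = c * pointValue u x := by
  obtain ⟨f, hf⟩ := exists_isContinuousRep hab h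
  rw [(hf.smul c).pointValue_eq hab hx, hf.pointValue_eq hab hx]
  rfl

theorem pointValue_zero {a b : ℝ} (hab : a < b) {x : ℝ} (hx : x ∈ Icc a b) :
    pointValue (0 : IntervalL2 a b) x = 0 := by
  simpa using pointValue_smul hab 0 (zero_mem (SobolevH1 a b)) hx

/-- `H¹_L(a, b) = {u ∈ H¹(a, b) : u(a) = 0}`. -/
def SobolevH1L {a b : ℝ} (hab : a < b) : Submodule ℂ (IntervalL2 a b) where
  carrier := {u | u ∈ SobolevH1 a b ∧ pointValue u a = 0}
  add_mem' := by
    rintro u u' ⟨h1, h2⟩ ⟨h1', h2'⟩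
    exact ⟨add_mem h1 h1', by
      rw [pointValue_add hab h1 h1' (left_mem_Icc.2 hab.le), h2, h2', add_zero]⟩
  zero_mem' := ⟨zero_mem _, pointValue_zero hab (left_mem_Icc.2 hab.le)⟩
  smul_mem' := by
    rintro c u ⟨h1, h2⟩
    exact ⟨Submodule.smul_mem _ c h1, by
      rw [pointValue_smul hab c h1 (left_mem_Icc.2 hab.le), h2, mul_zero]⟩

/-- `H¹_R(a, b) = {u ∈ H¹(a, b) : u(b) = 0}`. -/
def SobolevH1R {a b : ℝ} (hab : a < b) : Submodule ℂ (IntervalL2 a b) where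
  carrier := {u | u ∈ SobolevH1 a b ∧ pointValue u b = 0}
  add_mem' := by
    rintro u u' ⟨h1, h2⟩ ⟨h1', h2'⟩
    exact ⟨add_mem h1 h1', by
      rw [pointValue_add hab h1 h1' (right_mem_Icc.2 hab.le), h2, h2', add_zero]⟩
  zero_mem' := ⟨zero_mem _, pointValue_zero hab (right_mem_Icc.2 hab.le)⟩
  smul_mem' := by
    rintro c u ⟨h1, h2⟩
    exact ⟨Submodule.smul_mem _ c h1, by
      rw [pointValue_smul hab c h1 (right_mem_Icc.2 hab.le), h2, mul_zero]⟩

theorem eq_zero_of_weakDeriv_eq_zero {a b : ℝ} (hab : a < b) {u : IntervalL2 a b}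
    (hu : u ∈ SobolevH1R hab) (h : weakDeriv u = 0) : u = 0 := by
  have h1 := hasWeakDeriv_weakDeriv hu.1
  rw [h] at h1
  obtain ⟨c, hc⟩ := h1.exists_isContinuousRep hab
  have e (x : ℝ) (hx : x ∈ Icc a b) : ∫ t in a..x, (0 : IntervalL2 a b) t = 0 := by
    apply intervalIntegral.integral_zero_ae
    have h0 : ∀ᵐ t ∂volume.restrict (Ioc a b), (0 : IntervalL2 a b) t = 0 := by
      rw [← restrict_Ioo_eq_restrict_Ioc]
      exact Lp.coeFn_zero ℂ 2 (volume.restrict (Ioo a b))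
    rw [ae_restrict_iff' measurableSet_Ioc] at h0
    rw [uIoc_of_le hx.1]
    filter_upwards [h0] with t ht ht'
    exact ht ⟨ht'.1, ht'.2.trans hx.2⟩
  have hb := hc.pointValue_eq hab (right_mem_Icc.2 hab.le)
  rw [hu.2, e b (right_mem_Icc.2 hab.le), add_zero] at hb
  apply Lp.ext
  filter_upwards [hc.2, ae_restrict_mem measurableSet_Ioo,
    Lp.coeFn_zero ℂ 2 (volume.restrict (Ioo a b))] with x hx hx' h0
  rw [hx, e x (Ioo_subset_Icc_self hx'), ← hb, h0, add_zero]; rfl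

/-- The parameters of the coupled system: the lengths of the copper rod and of the beam, the thermal
diffusivity `κ`, the elastic stiffness `χ`, the piezoelectric coefficient `γ`, the impermeability
`β`, the mass density `ρ`, the magnetic permeability `mag` (written `μ` in formulas), and the order
`α` and exponential weight `η` of the fractional damping, with their standing assumptions. -/
structure SystemParams where
  ℓ₁ : ℝ
  ℓ₂ : ℝ
  κ : ℝ
  χ : ℝ
  γ : ℝ
  β : ℝ
  ρ : ℝ
  mag : ℝ
  α : ℝ
  η : ℝ
  ℓ₁_pos : 0 < ℓ₁
  ℓ₂_pos : 0 < ℓ₂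
  κ_pos : 0 < κ
  β_pos : 0 < β
  ρ_pos : 0 < ρ
  mag_pos : 0 < mag
  /-- The stiffness `χ₁ = χ - γ² β` of the fully elastic material is positive. -/
  χ₁_pos : 0 < χ - γ ^ 2 * β
  α_pos : 0 < α
  α_lt_one : α < 1
  η_nonneg : 0 ≤ η

namespace SystemParams

variable (par : SystemParams)

/-- `χ₁ = χ - γ² β`. -/
def χ₁ : ℝ := par.χ - par.γ ^ 2 * par.β

/-- The constant `sin(α π) / π`. -/
def fracConst : ℝ := Real.sin (par.α * Real.pi) / Real.pi

/-- The weight `μ(ξ) = |ξ| ^ ((2 α - 1) / 2)`. -/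
def weight (ξ : ℝ) : ℝ := |ξ| ^ ((2 * par.α - 1) / 2)

theorem neg_ℓ₁_lt_zero : -par.ℓ₁ < 0 := neg_lt_zero.2 par.ℓ₁_pos

theorem fracConst_pos : 0 < par.fracConst :=
  div_pos (Real.sin_pos_of_pos_of_lt_pi (mul_pos par.α_pos Real.pi_pos)
    (by nlinarith [par.α_lt_one, Real.pi_pos])) Real.pi_pos

theorem measurable_weight : Measurable par.weight := by
  unfold weight; fun_prop

theorem weight_sq (ξ : ℝ) : par.weight ξ ^ 2 = |ξ| ^ (2 * par.α - 1) := by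
  rw [weight, ← Real.rpow_natCast, ← Real.rpow_mul (abs_nonneg ξ)]
  congr 1; push_cast; ring

theorem integrable_weight_sq_div : Integrable fun ξ => par.weight ξ ^ 2 / (1 + ξ ^ 2) := by
  have hpos : IntegrableOn (fun ξ => par.weight ξ ^ 2 / (1 + ξ ^ 2)) (Ioi 0) := by
    rw [← Ioc_union_Ioi_eq_Ioi (zero_le_one' ℝ)]
    have hm : Measurable fun ξ => par.weight ξ ^ 2 / (1 + ξ ^ 2) :=
      (par.measurable_weight.pow_const 2).div (by fun_prop)
    apply IntegrableOn.union
    · have h1 : IntegrableOn (fun ξ : ℝ => ξ ^ (2 * par.α - 1)) (Ioc 0 1) := by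
        rw [← intervalIntegrable_iff_integrableOn_Ioc_of_le zero_le_one]
        exact intervalIntegral.intervalIntegrable_rpow' (by linarith [par.α_pos])
      refine h1.mono' hm.aestronglyMeasurable ?_
      filter_upwards [ae_restrict_mem measurableSet_Ioc] with ξ hξ
      rw [weight_sq, abs_of_pos hξ.1, Real.norm_of_nonneg (by have := hξ.1; positivity)]
      exact div_le_self (Real.rpow_nonneg hξ.1.le _) (by nlinarith)
    · have h1 : IntegrableOn (fun ξ : ℝ => ξ ^ (2 * par.α - 3)) (Ioi 1) :=
        integrableOn_Ioi_rpow_of_lt (by linarith [par.α_lt_one]) zero_lt_one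
      refine h1.mono' hm.aestronglyMeasurable ?_
      filter_upwards [ae_restrict_mem measurableSet_Ioi] with ξ hξ
      have h0 : 0 < ξ := zero_lt_one.trans hξ
      rw [weight_sq, abs_of_pos h0, Real.norm_of_nonneg (by positivity),
        show 2 * par.α - 3 = (2 * par.α - 1) - (2 : ℕ) by push_cast; ring,
        Real.rpow_sub_natCast h0.ne']
      exact div_le_div_of_nonneg_left (by positivity) (by positivity) (by linarith)
  have hneg : IntegrableOn (fun ξ => par.weight ξ ^ 2 / (1 + ξ ^ 2)) (Iio 0) := by
    have h := ((Measure.measurePreserving_neg (volume : Measure ℝ)).integrableOn_comp_preimage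
      (MeasurableEquiv.neg ℝ).measurableEmbedding (s := Ioi 0)
      (f := fun ξ => par.weight ξ ^ 2 / (1 + ξ ^ 2))).2 hpos
    have e : Neg.neg ⁻¹' Ioi (0 : ℝ) = Iio 0 := by ext x; simp
    rw [e] at h
    simpa [Function.comp_def, weight] using h
  rw [← integrableOn_univ, ← Iic_union_Ioi (a := (0 : ℝ))]
  refine IntegrableOn.union ?_ hpos
  rw [integrableOn_Iic_iff_integrableOn_Iio]
  exact hneg

/-- The product of vector spaces
`L²(-ℓ₁, 0) × H¹_R(0, ℓ₂) × L²(0, ℓ₂) × H¹_R(0, ℓ₂) × L²(0, ℓ₂) × L²(ℝ; L²(0, ℓ₂))`. -/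
abbrev EnergyProduct : Type :=
  IntervalL2 (-par.ℓ₁) 0 × SobolevH1R par.ℓ₂_pos × IntervalL2 0 par.ℓ₂ × SobolevH1R par.ℓ₂_pos ×
    IntervalL2 0 par.ℓ₂ × Lp (IntervalL2 0 par.ℓ₂) 2 (volume : Measure ℝ)

/-- The energy space: as a vector space the product above, with elements `U = (z, v, V, p, P, φ)`.
Its inner product is `SystemParams.EnergySpace.energyInner` below; the norm of the product is not
used. -/
def EnergySpace : Type := par.EnergyProduct

instance : AddCommGroup par.EnergySpace := inferInstanceAs (AddCommGroup par.EnergyProduct)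

instance : Module ℂ par.EnergySpace := inferInstanceAs (Module ℂ par.EnergyProduct)

end SystemParams

namespace SystemParams.EnergySpace

variable {par : SystemParams}

/-- The state `(z, v, V, p, P, φ)`. -/
def mk (z : IntervalL2 (-par.ℓ₁) 0) (v : SobolevH1R par.ℓ₂_pos) (V : IntervalL2 0 par.ℓ₂)
    (p : SobolevH1R par.ℓ₂_pos) (P : IntervalL2 0 par.ℓ₂)
    (φ : Lp (IntervalL2 0 par.ℓ₂) 2 (volume : Measure ℝ)) : par.EnergySpace :=
  (z, v, V, p, P, φ)

variable (U W : par.EnergySpace)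

/-- The component `z` (temperature of the rod). -/
def z : IntervalL2 (-par.ℓ₁) 0 := U.1
/-- The component `v` (longitudinal displacement of the beam). -/
def v : IntervalL2 0 par.ℓ₂ := U.2.1
/-- The component `V` (velocity of the beam). -/
def V : IntervalL2 0 par.ℓ₂ := U.2.2.1
/-- The component `p` (charge). -/
def p : IntervalL2 0 par.ℓ₂ := U.2.2.2.1
/-- The component `P` (current). -/
def P : IntervalL2 0 par.ℓ₂ := U.2.2.2.2.1
/-- The component `φ ∈ L²(ℝ; L²(0, ℓ₂))`, the auxiliary memory variable. -/
def φ : Lp (IntervalL2 0 par.ℓ₂) 2 (volume : Measure ℝ) := U.2.2.2.2.2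

theorem v_mem : U.v ∈ SobolevH1R par.ℓ₂_pos := U.2.1.2
theorem p_mem : U.p ∈ SobolevH1R par.ℓ₂_pos := U.2.2.2.1.2

@[simp] theorem add_z : (U + W).z = U.z + W.z := rfl
@[simp] theorem add_v : (U + W).v = U.v + W.v := rfl
@[simp] theorem add_V : (U + W).V = U.V + W.V := rfl
@[simp] theorem add_p : (U + W).p = U.p + W.p := rfl
@[simp] theorem add_P : (U + W).P = U.P + W.P := rfl
@[simp] theorem add_φ : (U + W).φ = U.φ + W.φ := rfl
@[simp] theorem zero_z : (0 : par.EnergySpace).z = 0 := rfl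
@[simp] theorem zero_v : (0 : par.EnergySpace).v = 0 := rfl
@[simp] theorem zero_V : (0 : par.EnergySpace).V = 0 := rfl
@[simp] theorem zero_p : (0 : par.EnergySpace).p = 0 := rfl
@[simp] theorem zero_P : (0 : par.EnergySpace).P = 0 := rfl
@[simp] theorem zero_φ : (0 : par.EnergySpace).φ = 0 := rfl
@[simp] theorem smul_z (c : ℂ) : (c • U).z = c • U.z := rfl
@[simp] theorem smul_v (c : ℂ) : (c • U).v = c • U.v := rfl
@[simp] theorem smul_V (c : ℂ) : (c • U).V = c • U.V := rfl
@[simp] theorem smul_p (c : ℂ) : (c • U).p = c • U.p := rfl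
@[simp] theorem smul_P (c : ℂ) : (c • U).P = c • U.P := rfl
@[simp] theorem smul_φ (c : ℂ) : (c • U).φ = c • U.φ := rfl

variable {U W} in
theorem ext (hz : U.z = W.z) (hv : U.v = W.v) (hV : U.V = W.V) (hp : U.p = W.p) (hP : U.P = W.P)
    (hφ : U.φ = W.φ) : U = W :=
  Prod.ext hz (Prod.ext (Subtype.ext hv) (Prod.ext hV (Prod.ext (Subtype.ext hp) (Prod.ext hP hφ))))

/-- The energy inner product
`∫ z z' + χ₁ ∫ v_x v'_x + ρ ∫ V V' + μ ∫ P P' + β ∫ (γ v_x - p_x) (γ v'_x - p'_x) + 𝔠 ∫∫ φ φ'`,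
with `𝔠 = sin(α π) / π`, conjugate linear in the first variable. -/
def energyInner : ℂ :=
  inner ℂ U.z W.z
    + par.χ₁ * inner ℂ (weakDeriv U.v) (weakDeriv W.v)
    + par.ρ * inner ℂ U.V W.V
    + par.mag * inner ℂ U.P W.P
    + par.β * inner ℂ ((par.γ : ℂ) • weakDeriv U.v - weakDeriv U.p)
        ((par.γ : ℂ) • weakDeriv W.v - weakDeriv W.p)
    + par.fracConst * inner ℂ U.φ W.φ

theorem re_energyInner_self : (energyInner U U).re =
    ‖U.z‖ ^ 2 + par.χ₁ * ‖weakDeriv U.v‖ ^ 2 + par.ρ * ‖U.V‖ ^ 2 + par.mag * ‖U.P‖ ^ 2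
      + par.β * ‖(par.γ : ℂ) • weakDeriv U.v - weakDeriv U.p‖ ^ 2
      + par.fracConst * ‖U.φ‖ ^ 2 := by
  simp only [energyInner, inner_self_eq_norm_sq_to_K, Complex.coe_algebraMap]
  norm_cast

/-- The energy inner product is positive definite. -/
@[reducible]
def energyCore : InnerProductSpace.Core ℂ par.EnergySpace where
  inner U W := energyInner U W
  conj_inner_symm U W := by
    simp only [energyInner, map_add, map_mul, inner_conj_symm, Complex.conj_ofReal]
  re_inner_nonneg U := by
    change 0 ≤ (energyInner U U).re
    rw [re_energyInner_self]
    have := par.χ₁_pos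
    have h1 : 0 < par.χ₁ := par.χ₁_pos
    have := par.ρ_pos
    have := par.mag_pos
    have := par.β_pos
    have := par.fracConst_pos
    positivity
  add_left U W X := by
    simp only [energyInner, add_z, add_v, add_V, add_p, add_P, add_φ,
      weakDeriv_add U.v_mem.1 W.v_mem.1, weakDeriv_add U.p_mem.1 W.p_mem.1, smul_add,
      add_sub_add_comm, inner_add_left]
    ring
  smul_left U W c := by
    simp only [energyInner, smul_z, smul_v, smul_V, smul_p, smul_P, smul_φ,
      weakDeriv_smul c U.v_mem.1, weakDeriv_smul c U.p_mem.1, smul_comm _ c,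
      ← smul_sub, inner_smul_left]
    ring
  definite U h := by
    have h0 : (energyInner U U).re = 0 := by
      change energyInner U U = 0 at h
      rw [h, Complex.zero_re]
    rw [re_energyInner_self] at h0
    have hχ : 0 < par.χ₁ := par.χ₁_pos
    have hρ := par.ρ_pos
    have hm := par.mag_pos
    have hβ := par.β_pos
    have hC := par.fracConst_pos
    have n1 := sq_nonneg ‖U.z‖
    have n2 := mul_nonneg hχ.le (sq_nonneg ‖weakDeriv U.v‖)
    have n3 := mul_nonneg hρ.le (sq_nonneg ‖U.V‖)
    have n4 := mul_nonneg hm.le (sq_nonneg ‖U.P‖)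
    have n5 := mul_nonneg hβ.le (sq_nonneg ‖(par.γ : ℂ) • weakDeriv U.v - weakDeriv U.p‖)
    have n6 := mul_nonneg hC.le (sq_nonneg ‖U.φ‖)
    have key {E : Type} [NormedAddCommGroup E] {c : ℝ} {x : E} (hc : 0 < c)
        (hx : c * ‖x‖ ^ 2 = 0) : x = 0 := by
      simpa [hc.ne'] using hx
    have ez : U.z = 0 := key one_pos (by linarith)
    have ev : weakDeriv U.v = 0 := key hχ (by linarith)
    have eV : U.V = 0 := key hρ (by linarith)
    have eP : U.P = 0 := key hm (by linarith)
    have ep : (par.γ : ℂ) • weakDeriv U.v - weakDeriv U.p = 0 := key hβ (by linarith)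
    have eφ : U.φ = 0 := key hC (by linarith)
    rw [ev, smul_zero, zero_sub, neg_eq_zero] at ep
    exact EnergySpace.ext ez (eq_zero_of_weakDeriv_eq_zero _ U.v_mem ev) eV
      (eq_zero_of_weakDeriv_eq_zero _ U.p_mem ep) eP eφ

instance : NormedAddCommGroup par.EnergySpace :=
  @InnerProductSpace.Core.toNormedAddCommGroup ℂ par.EnergySpace _ _ _ energyCore

instance : InnerProductSpace ℂ par.EnergySpace := InnerProductSpace.ofCore energyCore.toCore

theorem inner_def : inner ℂ U W = energyInner U W := rfl

theorem norm_sq : ‖U‖ ^ 2 =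
    ‖U.z‖ ^ 2 + par.χ₁ * ‖weakDeriv U.v‖ ^ 2 + par.ρ * ‖U.V‖ ^ 2 + par.mag * ‖U.P‖ ^ 2
      + par.β * ‖(par.γ : ℂ) • weakDeriv U.v - weakDeriv U.p‖ ^ 2
      + par.fracConst * ‖U.φ‖ ^ 2 := by
  rw [← re_energyInner_self, ← inner_self_eq_norm_sq (𝕜 := ℂ)]
  rfl

/-- Membership in the domain of the evolution operator: regularity, boundary conditions, and the
transmission conditions at the interface `x = 0`. -/
structure InDomain (U : par.EnergySpace) : Prop where
  z_mem_H1L : U.z ∈ SobolevH1L par.neg_ℓ₁_lt_zero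
  z_mem_H2 : U.z ∈ SobolevH2 (-par.ℓ₁) 0
  v_mem_H1R : U.v ∈ SobolevH1R par.ℓ₂_pos
  v_mem_H2 : U.v ∈ SobolevH2 0 par.ℓ₂
  p_mem_H1R : U.p ∈ SobolevH1R par.ℓ₂_pos
  p_mem_H2 : U.p ∈ SobolevH2 0 par.ℓ₂
  V_mem_H1R : U.V ∈ SobolevH1R par.ℓ₂_pos
  P_mem_H1R : U.P ∈ SobolevH1R par.ℓ₂_pos
  memLp_abs_smul : MemLp (fun ξ : ℝ => |ξ| • U.φ ξ) 2
  memLp_memory : MemLp (fun ξ : ℝ => -((|ξ| ^ 2 + par.η) • U.φ ξ) + par.weight ξ • U.V) 2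
  transmission : pointValue U.z 0 = pointValue U.V 0
  stress : par.χ * pointValue (weakDeriv U.v) 0 - par.γ * par.β * pointValue (weakDeriv U.p) 0
    = par.κ * pointValue (weakDeriv U.z) 0
  voltage : par.β * pointValue (weakDeriv U.p) 0 = par.γ * par.β * pointValue (weakDeriv U.v) 0

theorem InDomain.add {U W : par.EnergySpace} (hU : U.InDomain) (hW : W.InDomain) :
    (U + W).InDomain where
  z_mem_H1L := add_mem hU.z_mem_H1L hW.z_mem_H1L
  z_mem_H2 := add_mem hU.z_mem_H2 hW.z_mem_H2
  v_mem_H1R := add_mem hU.v_mem_H1R hW.v_mem_H1R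
  v_mem_H2 := add_mem hU.v_mem_H2 hW.v_mem_H2
  p_mem_H1R := add_mem hU.p_mem_H1R hW.p_mem_H1R
  p_mem_H2 := add_mem hU.p_mem_H2 hW.p_mem_H2
  V_mem_H1R := add_mem hU.V_mem_H1R hW.V_mem_H1R
  P_mem_H1R := add_mem hU.P_mem_H1R hW.P_mem_H1R
  memLp_abs_smul := by
    refine (hU.memLp_abs_smul.add hW.memLp_abs_smul).ae_eq ?_
    filter_upwards [Lp.coeFn_add U.φ W.φ] with ξ hξ
    rw [add_φ, hξ, Pi.add_apply, Pi.add_apply, smul_add]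
  memLp_memory := by
    refine (hU.memLp_memory.add hW.memLp_memory).ae_eq ?_
    filter_upwards [Lp.coeFn_add U.φ W.φ] with ξ hξ
    rw [add_φ, hξ, Pi.add_apply, Pi.add_apply, smul_add, add_V, smul_add]
    abel
  transmission := by
    rw [add_z, add_V, pointValue_add par.neg_ℓ₁_lt_zero hU.z_mem_H1L.1 hW.z_mem_H1L.1
      (right_mem_Icc.2 par.neg_ℓ₁_lt_zero.le), pointValue_add par.ℓ₂_pos hU.V_mem_H1R.1
      hW.V_mem_H1R.1 (left_mem_Icc.2 par.ℓ₂_pos.le), hU.transmission, hW.transmission]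
  stress := by
    rw [add_z, add_v, add_p, weakDeriv_add hU.z_mem_H2.1 hW.z_mem_H2.1,
      weakDeriv_add hU.v_mem_H2.1 hW.v_mem_H2.1, weakDeriv_add hU.p_mem_H2.1 hW.p_mem_H2.1,
      pointValue_add par.neg_ℓ₁_lt_zero hU.z_mem_H2.2 hW.z_mem_H2.2
        (right_mem_Icc.2 par.neg_ℓ₁_lt_zero.le),
      pointValue_add par.ℓ₂_pos hU.v_mem_H2.2 hW.v_mem_H2.2 (left_mem_Icc.2 par.ℓ₂_pos.le),
      pointValue_add par.ℓ₂_pos hU.p_mem_H2.2 hW.p_mem_H2.2 (left_mem_Icc.2 par.ℓ₂_pos.le)]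
    linear_combination hU.stress + hW.stress
  voltage := by
    rw [add_v, add_p,
      weakDeriv_add hU.v_mem_H2.1 hW.v_mem_H2.1, weakDeriv_add hU.p_mem_H2.1 hW.p_mem_H2.1,
      pointValue_add par.ℓ₂_pos hU.v_mem_H2.2 hW.v_mem_H2.2 (left_mem_Icc.2 par.ℓ₂_pos.le),
      pointValue_add par.ℓ₂_pos hU.p_mem_H2.2 hW.p_mem_H2.2 (left_mem_Icc.2 par.ℓ₂_pos.le)]
    linear_combination hU.voltage + hW.voltage

theorem InDomain.smul {U : par.EnergySpace} (c : ℂ) (hU : U.InDomain) : (c • U).InDomain where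
  z_mem_H1L := Submodule.smul_mem _ c hU.z_mem_H1L
  z_mem_H2 := Submodule.smul_mem _ c hU.z_mem_H2
  v_mem_H1R := Submodule.smul_mem _ c hU.v_mem_H1R
  v_mem_H2 := Submodule.smul_mem _ c hU.v_mem_H2
  p_mem_H1R := Submodule.smul_mem _ c hU.p_mem_H1R
  p_mem_H2 := Submodule.smul_mem _ c hU.p_mem_H2
  V_mem_H1R := Submodule.smul_mem _ c hU.V_mem_H1R
  P_mem_H1R := Submodule.smul_mem _ c hU.P_mem_H1R
  memLp_abs_smul := by
    refine (hU.memLp_abs_smul.const_smul c).ae_eq ?_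
    filter_upwards [Lp.coeFn_smul c U.φ] with ξ hξ
    rw [smul_φ, hξ, Pi.smul_apply, Pi.smul_apply, smul_comm]
  memLp_memory := by
    refine (hU.memLp_memory.const_smul c).ae_eq ?_
    filter_upwards [Lp.coeFn_smul c U.φ] with ξ hξ
    rw [smul_φ, hξ, Pi.smul_apply, Pi.smul_apply, smul_V, smul_comm _ c, smul_comm _ c,
      smul_add, smul_neg]
  transmission := by
    rw [smul_z, smul_V, pointValue_smul par.neg_ℓ₁_lt_zero c hU.z_mem_H1L.1
      (right_mem_Icc.2 par.neg_ℓ₁_lt_zero.le), pointValue_smul par.ℓ₂_pos c hU.V_mem_H1R.1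
      (left_mem_Icc.2 par.ℓ₂_pos.le), hU.transmission]
  stress := by
    rw [smul_z, smul_v, smul_p, weakDeriv_smul c hU.z_mem_H2.1,
      weakDeriv_smul c hU.v_mem_H2.1, weakDeriv_smul c hU.p_mem_H2.1,
      pointValue_smul par.neg_ℓ₁_lt_zero c hU.z_mem_H2.2 (right_mem_Icc.2 par.neg_ℓ₁_lt_zero.le),
      pointValue_smul par.ℓ₂_pos c hU.v_mem_H2.2 (left_mem_Icc.2 par.ℓ₂_pos.le),
      pointValue_smul par.ℓ₂_pos c hU.p_mem_H2.2 (left_mem_Icc.2 par.ℓ₂_pos.le)]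
    linear_combination c * hU.stress
  voltage := by
    rw [smul_v, smul_p, weakDeriv_smul c hU.v_mem_H2.1, weakDeriv_smul c hU.p_mem_H2.1,
      pointValue_smul par.ℓ₂_pos c hU.v_mem_H2.2 (left_mem_Icc.2 par.ℓ₂_pos.le),
      pointValue_smul par.ℓ₂_pos c hU.p_mem_H2.2 (left_mem_Icc.2 par.ℓ₂_pos.le)]
    linear_combination c * hU.voltage

theorem InDomain.zero : (0 : par.EnergySpace).InDomain where
  z_mem_H1L := zero_mem _
  z_mem_H2 := zero_mem _
  v_mem_H1R := zero_mem _
  v_mem_H2 := zero_mem _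
  p_mem_H1R := zero_mem _
  p_mem_H2 := zero_mem _
  V_mem_H1R := zero_mem _
  P_mem_H1R := zero_mem _
  memLp_abs_smul := by
    refine (MemLp.zero (ε := IntervalL2 0 par.ℓ₂)).ae_eq (Eventually.of_forall fun ξ => ?_)
    simp
  memLp_memory := by
    refine (MemLp.zero (ε := IntervalL2 0 par.ℓ₂)).ae_eq (Eventually.of_forall fun ξ => ?_)
    simp
  transmission := by
    rw [zero_z, zero_V, pointValue_zero par.neg_ℓ₁_lt_zero (right_mem_Icc.2 par.neg_ℓ₁_lt_zero.le),
      pointValue_zero par.ℓ₂_pos (left_mem_Icc.2 par.ℓ₂_pos.le)]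
  stress := by
    rw [zero_z, zero_v, zero_p, weakDeriv_zero, weakDeriv_zero,
      pointValue_zero par.neg_ℓ₁_lt_zero (right_mem_Icc.2 par.neg_ℓ₁_lt_zero.le),
      pointValue_zero par.ℓ₂_pos (left_mem_Icc.2 par.ℓ₂_pos.le)]
    ring
  voltage := by
    rw [zero_v, zero_p, weakDeriv_zero, pointValue_zero par.ℓ₂_pos (left_mem_Icc.2 par.ℓ₂_pos.le)]
    ring

/-- On the domain, `∫ μ(ξ) φ(ξ) dξ` is an absolutely convergent Bochner integral in `L²(0, ℓ₂)`. -/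
theorem InDomain.integrable {U : par.EnergySpace} (hU : U.InDomain) :
    Integrable fun ξ : ℝ => par.weight ξ • U.φ ξ := by
  have h1 : Integrable fun ξ : ℝ => ‖U.φ ξ‖ ^ 2 :=
    (memLp_two_iff_integrable_sq_norm (Lp.memLp U.φ).1).1 (Lp.memLp U.φ)
  have h2 : Integrable fun ξ : ℝ => ‖|ξ| • U.φ ξ‖ ^ 2 :=
    (memLp_two_iff_integrable_sq_norm hU.memLp_abs_smul.1).1 hU.memLp_abs_smul
  refine ((par.integrable_weight_sq_div.add h1).add h2).mono'
    (par.measurable_weight.aestronglyMeasurable.smul (Lp.memLp U.φ).1)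
    (Eventually.of_forall fun ξ => ?_)
  simp only [Pi.add_apply, norm_smul, mul_pow, norm_abs_eq_norm, Real.norm_eq_abs, sq_abs]
  have hs : (0 : ℝ) < 1 + ξ ^ 2 := by positivity
  rw [← sq_abs (par.weight ξ)]
  set a := |par.weight ξ|
  set b := ‖U.φ ξ‖
  have ha : 0 ≤ a := abs_nonneg _
  have hb : 0 ≤ b := norm_nonneg _
  have : a * b ≤ a ^ 2 / (1 + ξ ^ 2) + (1 + ξ ^ 2) * b ^ 2 := by
    rw [div_add' _ _ _ hs.ne', le_div_iff₀ hs]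
    nlinarith [sq_nonneg (a - (1 + ξ ^ 2) * b), mul_nonneg ha hb, mul_nonneg (mul_nonneg ha hb) hs.le]
  linarith

variable (par) in
/-- The domain of the evolution operator, a subspace of the energy space. -/
def domain : Submodule ℂ par.EnergySpace where
  carrier := {U | U.InDomain}
  add_mem' hU hW := hU.add hW
  zero_mem' := InDomain.zero
  smul_mem' c _ hU := hU.smul c

/-- The value
`(κ z_xx, V, (χ v_xx - γ β p_xx - 𝔠 ∫ μ(ξ) φ(ξ) dξ) / ρ, P, (β p_xx - γ β v_xx) / μ,
-(|ξ|² + η) φ(ξ) + μ(ξ) V)` of the evolution operator at a state `U` of its domain. -/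
def evolutionFun (U : par.EnergySpace) (hU : U.InDomain) : par.EnergySpace :=
  mk (par.κ • weakDeriv (weakDeriv U.z))
    ⟨U.V, hU.V_mem_H1R⟩
    ((1 / par.ρ) • (par.χ • weakDeriv (weakDeriv U.v)
      - (par.γ * par.β) • weakDeriv (weakDeriv U.p)
      - par.fracConst • ∫ ξ : ℝ, par.weight ξ • U.φ ξ))
    ⟨U.P, hU.P_mem_H1R⟩
    ((1 / par.mag) • (par.β • weakDeriv (weakDeriv U.p)
      - (par.γ * par.β) • weakDeriv (weakDeriv U.v)))
    (hU.memLp_memory.toLp fun ξ : ℝ => -((|ξ| ^ 2 + par.η) • U.φ ξ) + par.weight ξ • U.V)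

section

variable {U W : par.EnergySpace}

theorem evolutionFun_z (hU : U.InDomain) :
    (evolutionFun U hU).z = par.κ • weakDeriv (weakDeriv U.z) := rfl

theorem evolutionFun_v (hU : U.InDomain) : (evolutionFun U hU).v = U.V := rfl

theorem evolutionFun_V (hU : U.InDomain) :
    (evolutionFun U hU).V = (1 / par.ρ) • (par.χ • weakDeriv (weakDeriv U.v)
      - (par.γ * par.β) • weakDeriv (weakDeriv U.p)
      - par.fracConst • ∫ ξ : ℝ, par.weight ξ • U.φ ξ) := rfl

theorem evolutionFun_p (hU : U.InDomain) : (evolutionFun U hU).p = U.P := rfl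

theorem evolutionFun_P (hU : U.InDomain) :
    (evolutionFun U hU).P = (1 / par.mag) • (par.β • weakDeriv (weakDeriv U.p)
      - (par.γ * par.β) • weakDeriv (weakDeriv U.v)) := rfl

theorem evolutionFun_φ (hU : U.InDomain) :
    (evolutionFun U hU).φ = hU.memLp_memory.toLp
      fun ξ : ℝ => -((|ξ| ^ 2 + par.η) • U.φ ξ) + par.weight ξ • U.V := rfl

theorem evolutionFun_add (hU : U.InDomain) (hW : W.InDomain) :
    evolutionFun (U + W) (hU.add hW) = evolutionFun U hU + evolutionFun W hW := by
  have ez : weakDeriv (weakDeriv (U.z + W.z)) =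
      weakDeriv (weakDeriv U.z) + weakDeriv (weakDeriv W.z) := by
    rw [weakDeriv_add hU.z_mem_H2.1 hW.z_mem_H2.1, weakDeriv_add hU.z_mem_H2.2 hW.z_mem_H2.2]
  have ev : weakDeriv (weakDeriv (U.v + W.v)) =
      weakDeriv (weakDeriv U.v) + weakDeriv (weakDeriv W.v) := by
    rw [weakDeriv_add hU.v_mem_H2.1 hW.v_mem_H2.1, weakDeriv_add hU.v_mem_H2.2 hW.v_mem_H2.2]
  have ep : weakDeriv (weakDeriv (U.p + W.p)) =
      weakDeriv (weakDeriv U.p) + weakDeriv (weakDeriv W.p) := by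
    rw [weakDeriv_add hU.p_mem_H2.1 hW.p_mem_H2.1, weakDeriv_add hU.p_mem_H2.2 hW.p_mem_H2.2]
  have ei : ∫ ξ : ℝ, par.weight ξ • (U.φ + W.φ) ξ =
      (∫ ξ : ℝ, par.weight ξ • U.φ ξ) + ∫ ξ : ℝ, par.weight ξ • W.φ ξ := by
    rw [← integral_add hU.integrable hW.integrable]
    apply integral_congr_ae
    filter_upwards [Lp.coeFn_add U.φ W.φ] with ξ hξ
    rw [hξ, Pi.add_apply, smul_add]
  apply EnergySpace.ext
  · rw [add_z, evolutionFun_z, evolutionFun_z, evolutionFun_z, add_z, ez, smul_add]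
  · rw [add_v, evolutionFun_v, evolutionFun_v, evolutionFun_v, add_V]
  · rw [add_V, evolutionFun_V, evolutionFun_V, evolutionFun_V, add_v, add_p, add_φ, ev, ep, ei]
    simp only [smul_add, smul_sub]
    abel
  · rw [add_p, evolutionFun_p, evolutionFun_p, evolutionFun_p, add_P]
  · rw [add_P, evolutionFun_P, evolutionFun_P, evolutionFun_P, add_v, add_p, ev, ep]
    simp only [smul_add, smul_sub]
    abel
  · rw [add_φ, evolutionFun_φ, evolutionFun_φ, evolutionFun_φ, ← MemLp.toLp_add,
      MemLp.toLp_eq_toLp_iff]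
    filter_upwards [Lp.coeFn_add U.φ W.φ] with ξ hξ
    rw [add_φ, hξ, Pi.add_apply, Pi.add_apply, smul_add, add_V, smul_add]
    abel

theorem evolutionFun_smul (c : ℂ) (hU : U.InDomain) :
    evolutionFun (c • U) (hU.smul c) = c • evolutionFun U hU := by
  have ez : weakDeriv (weakDeriv (c • U.z)) = c • weakDeriv (weakDeriv U.z) := by
    rw [weakDeriv_smul c hU.z_mem_H2.1, weakDeriv_smul c hU.z_mem_H2.2]
  have ev : weakDeriv (weakDeriv (c • U.v)) = c • weakDeriv (weakDeriv U.v) := by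
    rw [weakDeriv_smul c hU.v_mem_H2.1, weakDeriv_smul c hU.v_mem_H2.2]
  have ep : weakDeriv (weakDeriv (c • U.p)) = c • weakDeriv (weakDeriv U.p) := by
    rw [weakDeriv_smul c hU.p_mem_H2.1, weakDeriv_smul c hU.p_mem_H2.2]
  have ei : ∫ ξ : ℝ, par.weight ξ • (c • U.φ) ξ = c • ∫ ξ : ℝ, par.weight ξ • U.φ ξ := by
    rw [← integral_smul]
    apply integral_congr_ae
    filter_upwards [Lp.coeFn_smul c U.φ] with ξ hξ
    rw [hξ, Pi.smul_apply, smul_comm]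
  apply EnergySpace.ext
  · rw [smul_z, evolutionFun_z, evolutionFun_z, smul_z, ez, smul_comm]
  · rw [smul_v, evolutionFun_v, evolutionFun_v, smul_V]
  · rw [smul_V, evolutionFun_V, evolutionFun_V, smul_v, smul_p, smul_φ, ev, ep, ei]
    simp only [smul_sub, smul_comm c]
  · rw [smul_p, evolutionFun_p, evolutionFun_p, smul_P]
  · rw [smul_P, evolutionFun_P, evolutionFun_P, smul_v, smul_p, ev, ep]
    simp only [smul_sub, smul_comm c]
  · rw [smul_φ, evolutionFun_φ, evolutionFun_φ, ← MemLp.toLp_const_smul, MemLp.toLp_eq_toLp_iff]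
    filter_upwards [Lp.coeFn_smul c U.φ] with ξ hξ
    rw [smul_φ, hξ, Pi.smul_apply, Pi.smul_apply, smul_V, smul_comm _ c, smul_comm _ c,
      smul_add, smul_neg]

end

end SystemParams.EnergySpace

open SystemParams.EnergySpace in
/-- The evolution operator of the coupled system, an unbounded linear operator on the energy space. -/
def SystemParams.evolutionOperator (par : SystemParams) : par.EnergySpace →ₗ.[ℂ] par.EnergySpace where
  domain := SystemParams.EnergySpace.domain par
  toFun :=
    { toFun := fun U => evolutionFun U.1 U.2
      map_add' := fun U W => evolutionFun_add U.2 W.2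
      map_smul' := fun c U => evolutionFun_smul c U.2 }

/-- A strongly continuous one-parameter semigroup of bounded linear operators. -/
structure C0Semigroup (X : Type*) [NormedAddCommGroup X] [NormedSpace ℂ X] where
  toFun : ℝ≥0 → X →L[ℂ] X
  map_zero : toFun 0 = ContinuousLinearMap.id ℂ X
  map_add : ∀ s t, toFun (s + t) = (toFun s).comp (toFun t)
  tendsto_zero : ∀ x, Tendsto (fun t => toFun t x) (𝓝 0) (𝓝 x)

namespace C0Semigroup

variable {X : Type*} [NormedAddCommGroup X] [NormedSpace ℂ X] (S : C0Semigroup X)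

/-- Every operator of the semigroup has norm at most one. -/
def IsContraction : Prop := ∀ t, ‖S.toFun t‖ ≤ 1

/-- `A` is the infinitesimal generator: `x` lies in the domain of `A` and `A x = y` exactly when
`(S(t) x - x) / t → y` as `t → 0+`. -/
def IsGenerator (A : X →ₗ.[ℂ] X) : Prop :=
  ∀ x y : X, (x, y) ∈ A.graph ↔
    Tendsto (fun t : ℝ≥0 => (((t : ℝ) : ℂ)⁻¹) • (S.toFun t x - x)) (𝓝[>] 0) (𝓝 y)

end C0Semigroup

end

/-!
By the Lumer–Phillips theorem it suffices that the evolution operator `A` is dissipative for the energy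
inner product, that `1 - A` is onto, and that the energy space is complete. None of the semigroup
theory is taken for granted: `LinearPMap.IsDissipative.exists_c0Semigroup` constructs the semigroup as
the limit of the exponentials of the Yosida approximations of `A`. The range condition passes from `1`
to `(3 / 2) ^ n` by Neumann series, density of the domain is automatic in a Hilbert space, and the
generator is not a proper extension of `A` because generators of contraction semigroups are
dissipative.

The energy space is complete because `(z, v, V, p, P, φ) ↦ (z, v_x, V, p_x, P, φ)` identifies it, up to
equivalence of norms, with a product of `L²` spaces (`SystemParams.EnergySpace.weakDerivsEquiv`).

Dissipativity is integration by parts (`HasWeakDeriv.inner_add_inner`). With the stress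
`σ = χ v_x - γ β p_x` and the voltage `τ = β p_x - γ β v_x`, the strain terms are skew, the
transmission conditions cancel the boundary terms at `0`, and
`Re ⟪A U, U⟫ = -κ ‖z_x‖² - 𝔠 ∫ (|ξ|² + η) ‖φ(ξ)‖² dξ`.

For the equation `U - A U = F`, the last component gives `φ = (F_φ + μ V) / (1 + |ξ|² + η)`, and the
second and fourth give `v = V + F_v` and `p = P + F_p`. The integral of `μ φ` is then a datum plus a
nonnegative multiple of `V`, so that the memory acts as an additional mass density
(`SystemParams.addedMass`). There remains an elliptic transmission problem for `(z, V, P)` whose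
sesquilinear form is an inner product, namely the energy inner product of `(z, V, V, P, P, 0)` plus
`κ ⟪z_x, z_x⟫`. The map `(z, V, P) ↦ ((z, V, V, P, P, 0), √κ z_x)` is isometric for this
inner product, and the weak solution is the orthogonal projection of the data onto the closed subspace
`SystemParams.formSpace` of these vectors, with arbitrary last component `φ`
(`SystemParams.exists_weak_solution`). Regularity and the transmission conditions follow by testing
(`SystemParams.exists_strong_solution`).
-/

/-! ### Exponentials of bounded dissipative operators -/

section Dissipative

variable {X : Type*} [NormedAddCommGroup X] [InnerProductSpace ℂ X]

/-- The real derivative of the orbit `s ↦ T(s) x` of an operator-valued function. -/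
theorem HasDerivAt.clm_apply_const {T : ℝ → X →L[ℂ] X} {T' : X →L[ℂ] X} {s : ℝ}
    (h : HasDerivAt T T' s) (x : X) : HasDerivAt (fun s => T s x) (T' x) s :=
  ((ContinuousLinearMap.apply ℂ X x).restrictScalars ℝ).hasFDerivAt.comp_hasDerivAt s h

variable [CompleteSpace X] {B C : X →L[ℂ] X}

theorem norm_exp_smul_apply_le (hB : ∀ x, (inner ℂ (B x) x).re ≤ 0) {t : ℝ} (ht : 0 ≤ t) (x : X) :
    ‖NormedSpace.exp (t • B) x‖ ≤ ‖x‖ := by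
  let _ : InnerProductSpace ℝ X := InnerProductSpace.complexToReal
  have hd (s : ℝ) : HasDerivAt (fun s : ℝ => NormedSpace.exp (s • B) x)
      (B (NormedSpace.exp (s • B) x)) s :=
    (hasDerivAt_exp_smul_const' B s).clm_apply_const x
  have hn (s : ℝ) := (hd s).norm_sq
  have hanti : Antitone fun s : ℝ => ‖NormedSpace.exp (s • B) x‖ ^ 2 := by
    refine antitone_of_deriv_nonpos (fun s => (hn s).differentiableAt) fun s => ?_
    rw [(hn s).deriv, real_inner_comm]
    have := hB (NormedSpace.exp (s • B) x)
    have e : inner ℝ (B (NormedSpace.exp (s • B) x)) (NormedSpace.exp (s • B) x) =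
      (inner ℂ (B (NormedSpace.exp (s • B) x)) (NormedSpace.exp (s • B) x)).re := rfl
    linarith
  have := hanti ht
  simp only [zero_smul, NormedSpace.exp_zero, one_apply_eq_self] at this
  exact le_of_sq_le_sq this (norm_nonneg _)

/-- The orbits of two commuting contraction semigroups with bounded generators differ, up to time
`t`, by at most `t` times the difference of the generators: differentiate `exp(s B) exp((t - s) C)`
in `s`. -/
theorem norm_exp_smul_sub_exp_smul_le (hB : ∀ x, (inner ℂ (B x) x).re ≤ 0)
    (hC : ∀ x, (inner ℂ (C x) x).re ≤ 0) (hBC : Commute B C) {t : ℝ} (ht : 0 ≤ t) (x : X) :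
    ‖NormedSpace.exp (t • B) x - NormedSpace.exp (t • C) x‖ ≤ t * ‖B x - C x‖ := by
  let f : ℝ → X := fun s => (NormedSpace.exp (s • B) * NormedSpace.exp ((t - s) • C)) x
  have hd (s : ℝ) : HasDerivAt f
      (NormedSpace.exp (s • B) (NormedSpace.exp ((t - s) • C) (B x - C x))) s := by
    have h1 := hasDerivAt_exp_smul_const B s
    have h2 := (hasDerivAt_exp_smul_const' C (t - s)).scomp s ((hasDerivAt_id s).const_sub t)
    have h3 := (h1.mul h2).clm_apply_const x
    refine h3.congr_deriv ?_
    have c1 : Commute (NormedSpace.exp ((t - s) • C)) B :=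
      ((hBC.symm.smul_left (t - s)).exp_left)
    have c2 : Commute (NormedSpace.exp ((t - s) • C)) C :=
      (((Commute.refl C).smul_left (t - s)).exp_left)
    have e1 := congrArg (fun T : X →L[ℂ] X => T x) c1.eq
    have e2 := congrArg (fun T : X →L[ℂ] X => T x) c2.eq
    simp only [mul_apply_eq_comp] at e1 e2
    rw [map_sub, e1, e2, map_sub]
    simp [sub_eq_add_neg]
  have := (convex_Icc (0 : ℝ) t).norm_image_sub_le_of_norm_hasDerivWithin_le (f := f)
    (fun s _ => (hd s).hasDerivWithinAt) (C := ‖B x - C x‖) (fun s hs =>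
      (norm_exp_smul_apply_le hB hs.1 _).trans (norm_exp_smul_apply_le hC (sub_nonneg.2 hs.2) _))
    (left_mem_Icc.2 ht) (right_mem_Icc.2 ht)
  simpa [f, abs_of_nonneg ht, mul_comm] using this

theorem norm_exp_smul_sub_le (hB : ∀ x, (inner ℂ (B x) x).re ≤ 0) {t : ℝ} (ht : 0 ≤ t) (x : X) :
    ‖NormedSpace.exp (t • B) x - x‖ ≤ t * ‖B x‖ := by
  simpa using norm_exp_smul_sub_exp_smul_le (C := 0) hB (by simp) (Commute.zero_right B) ht x

end Dissipative

/-! ### Resolvents of maximal dissipative operators -/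

namespace LinearPMap

variable {X : Type*} [NormedAddCommGroup X] [InnerProductSpace ℂ X] {A : X →ₗ.[ℂ] X}

/-- `A` is dissipative: `Re ⟪A x, x⟫ ≤ 0` on the domain. -/
def IsDissipative (A : X →ₗ.[ℂ] X) : Prop := ∀ x : A.domain, (inner ℂ (A x) (x : X)).re ≤ 0

/-- The bounded operator `R` is a right inverse of `l - A`. For a dissipative operator and `l > 0`
it is then the resolvent, see `IsRightResolvent.apply_sub`. -/
def IsRightResolvent (A : X →ₗ.[ℂ] X) (l : ℝ) (R : X →L[ℂ] X) : Prop :=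
  ∀ y, ∃ h : R y ∈ A.domain, (l : ℂ) • R y - A ⟨R y, h⟩ = y

theorem IsDissipative.norm_le (hA : A.IsDissipative) (l : ℝ) (x : A.domain) :
    l * ‖(x : X)‖ ≤ ‖(l : ℂ) • (x : X) - A x‖ := by
  rcases eq_or_ne (x : X) 0 with h0 | h0
  · simp [h0]
  have h1 : (inner ℂ ((l : ℂ) • (x : X) - A x) (x : X)).re =
      l * ‖(x : X)‖ ^ 2 - (inner ℂ (A x) (x : X)).re := by
    rw [inner_sub_left, inner_smul_left, inner_self_eq_norm_sq_to_K, Complex.sub_re]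
    simp only [Complex.conj_ofReal, Complex.coe_algebraMap]
    norm_cast
  have h2 := (Complex.re_le_norm _).trans (norm_inner_le_norm (𝕜 := ℂ) ((l : ℂ) • (x : X) - A x) x)
  have h3 := hA x
  have h4 : 0 < ‖(x : X)‖ := norm_pos_iff.2 h0
  refine le_of_mul_le_mul_right ?_ h4
  nlinarith

theorem IsDissipative.eq_of_sub_eq (hA : A.IsDissipative) {l : ℝ} (hl : 0 < l) {x y : A.domain}
    (h : (l : ℂ) • (x : X) - A x = (l : ℂ) • (y : X) - A y) : x = y := by
  have := hA.norm_le l (x - y)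
  rw [LinearPMap.map_sub, Submodule.coe_sub, smul_sub, sub_sub_sub_comm, h, sub_self, norm_zero] at this
  have h0 : ‖(x : X) - y‖ ≤ 0 := by
    by_contra hc
    exact absurd this (not_le.2 (mul_pos hl (not_le.1 hc)))
  exact Subtype.ext (sub_eq_zero.1 (norm_le_zero_iff.1 h0))

theorem IsDissipative.exists_isRightResolvent (hA : A.IsDissipative) {l : ℝ} (hl : 0 < l)
    (h : ∀ y, ∃ x : A.domain, (l : ℂ) • (x : X) - A x = y) : ∃ R, A.IsRightResolvent l R := by
  choose r hr using h
  refine ⟨LinearMap.mkContinuous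
    { toFun := fun y => (r y : X)
      map_add' := fun x y => ?_
      map_smul' := fun c x => ?_ } l⁻¹ fun y => ?_, fun y => ⟨(r y).2, hr y⟩⟩
  · rw [← Submodule.coe_add]
    congr 1
    apply hA.eq_of_sub_eq hl
    rw [map_add, Submodule.coe_add, smul_add, add_sub_add_comm, hr, hr, hr]
  · rw [RingHom.id_apply, ← Submodule.coe_smul]
    congr 1
    apply hA.eq_of_sub_eq hl
    rw [LinearPMap.map_smul, Submodule.coe_smul, smul_comm, ← smul_sub, hr, hr]
  · have := hA.norm_le l (r y)
    rw [hr] at this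
    rw [inv_mul_eq_div, le_div_iff₀ hl, mul_comm]
    exact this

section Resolvent

variable {l m : ℝ} {R Q : X →L[ℂ] X}

theorem IsRightResolvent.mem (hR : A.IsRightResolvent l R) (y : X) : R y ∈ A.domain := (hR y).1

theorem IsRightResolvent.apply_mk (hR : A.IsRightResolvent l R) (y : X) :
    A ⟨R y, hR.mem y⟩ = (l : ℂ) • R y - y := by
  have := (hR y).2
  rw [sub_eq_iff_eq_add] at this
  rw [this]; abel

theorem IsRightResolvent.apply_sub (hR : A.IsRightResolvent l R) (hA : A.IsDissipative)
    (hl : 0 < l) (x : A.domain) : R ((l : ℂ) • (x : X) - A x) = x := by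
  have h := (hR ((l : ℂ) • (x : X) - A x))
  exact congrArg Subtype.val (hA.eq_of_sub_eq hl (x := ⟨_, h.1⟩) h.2)

theorem IsRightResolvent.norm_le (hR : A.IsRightResolvent l R) (hA : A.IsDissipative)
    (hl : 0 < l) : ‖R‖ ≤ l⁻¹ := by
  refine R.opNorm_le_bound (inv_nonneg.2 hl.le) fun y => ?_
  have := hA.norm_le l ⟨R y, hR.mem y⟩
  rw [(hR y).2] at this
  rw [inv_mul_eq_div, le_div_iff₀ hl, mul_comm]
  exact this

/-- The resolvent identity `R - Q = (m - l) R Q`. -/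
theorem IsRightResolvent.sub_eq (hR : A.IsRightResolvent l R) (hQ : A.IsRightResolvent m Q)
    (hA : A.IsDissipative) (hl : 0 < l) : R - Q = ((m - l : ℝ) : ℂ) • (R * Q) := by
  ext y
  have h := hR.apply_sub hA hl ⟨Q y, hQ.mem y⟩
  rw [hQ.apply_mk] at h
  have e : (l : ℂ) • Q y - ((m : ℂ) • Q y - y) = y - ((m - l : ℝ) : ℂ) • Q y := by
    push_cast
    rw [sub_smul]
    abel
  rw [e, _root_.map_sub, _root_.map_smul, sub_eq_iff_eq_add] at h
  simp [h]

theorem IsRightResolvent.commute (hR : A.IsRightResolvent l R) (hQ : A.IsRightResolvent m Q)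
    (hA : A.IsDissipative) (hl : 0 < l) (hm : 0 < m) : Commute R Q := by
  rcases eq_or_ne l m with rfl | hlm
  · have := hR.sub_eq hQ hA hl
    rw [sub_self, Complex.ofReal_zero, zero_smul, sub_eq_zero] at this
    rw [this]
  · have h1 := hR.sub_eq hQ hA hl
    have h2 := hQ.sub_eq hR hA hm
    rw [← neg_sub, h1, ← neg_sub m l, Complex.ofReal_neg, neg_smul, neg_inj] at h2
    exact smul_right_injective _ (Complex.ofReal_ne_zero.2 (sub_ne_zero.2 hlm.symm)) h2

/-- The range condition propagates from `l` to `3 l / 2`, by a Neumann series. -/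
theorem IsRightResolvent.exists_three_halves [CompleteSpace X] (hR : A.IsRightResolvent l R)
    (hA : A.IsDissipative) (hl : 0 < l) : ∃ Q, A.IsRightResolvent (3 / 2 * l) Q := by
  refine hA.exists_isRightResolvent (by positivity) fun y => ?_
  -- Solve `w + (l / 2) R w = y`; then `x = R w` satisfies `3 l / 2 x - A x = w + (l / 2) R w`.
  have hn : ‖-(((l / 2 : ℝ) : ℂ) • R)‖ < 1 := by
    rw [norm_neg, norm_smul, Complex.norm_real, Real.norm_of_nonneg (by positivity)]
    calc l / 2 * ‖R‖ ≤ l / 2 * l⁻¹ := by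
          gcongr
          exact hR.norm_le hA hl
      _ = 1 / 2 := by field_simp
      _ < 1 := by norm_num
  obtain ⟨u, hu⟩ := isUnit_one_sub_of_norm_lt_one hn
  set w := (↑u⁻¹ : X →L[ℂ] X) y with hw
  have e : w + ((l / 2 : ℝ) : ℂ) • R w = y := by
    have := congrArg (fun T : X →L[ℂ] X => T y) u.mul_inv
    simp only [mul_apply_eq_comp, hu] at this
    simpa [hw] using this
  refine ⟨⟨R w, hR.mem w⟩, ?_⟩
  rw [hR.apply_mk]
  conv_rhs => rw [← e]
  push_cast
  rw [show (3 / 2 * (l : ℂ)) = l / 2 + l by ring, add_smul]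
  abel

theorem IsDissipative.exists_isRightResolvent_pow [CompleteSpace X] (hA : A.IsDissipative)
    (h : ∀ y, ∃ x : A.domain, (x : X) - A x = y) (n : ℕ) :
    ∃ R, A.IsRightResolvent ((3 / 2 : ℝ) ^ n) R := by
  induction n with
  | zero => exact hA.exists_isRightResolvent (by norm_num) (by simpa using h)
  | succ n ih =>
    obtain ⟨R, hR⟩ := ih
    rw [pow_succ']
    exact hR.exists_three_halves hA (by positivity)

/-- A dissipative operator `A` with `1 - A` onto is densely defined: if `f` is orthogonal to the
domain and `f = x - A x`, then `‖x‖² = Re ⟪A x, x⟫ ≤ 0`. -/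
theorem IsDissipative.dense_domain [CompleteSpace X] (hA : A.IsDissipative)
    (h : ∀ y, ∃ x : A.domain, (x : X) - A x = y) : Dense (A.domain : Set X) := by
  rw [Submodule.dense_iff_topologicalClosure_eq_top,
    Submodule.topologicalClosure_eq_top_iff, Submodule.eq_bot_iff]
  intro f hf
  obtain ⟨x, rfl⟩ := h f
  have h0 := hf x x.2
  have h1 := hA x
  rw [inner_sub_right, sub_eq_zero, inner_self_eq_norm_sq_to_K] at h0
  have h2 : (inner ℂ (x : X) (A x)).re = ‖(x : X)‖ ^ 2 := by
    rw [← h0]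
    simp only [Complex.coe_algebraMap]
    norm_cast
  rw [← inner_conj_symm, Complex.conj_re, h2] at h1
  have h3 : (x : X) = 0 := by
    have : ‖(x : X)‖ = 0 := by nlinarith [norm_nonneg (x : X)]
    exact norm_eq_zero.1 this
  have h4 : x = 0 := Subtype.ext h3
  rw [h4, map_zero, Submodule.coe_zero, sub_zero]

/-- The Yosida approximation `l A R = l² R - l` of `A`. -/
noncomputable def yosida (l : ℝ) (R : X →L[ℂ] X) : X →L[ℂ] X := (l : ℂ) • ((l : ℂ) • R - 1)

theorem IsRightResolvent.re_inner_yosida_le (hR : A.IsRightResolvent l R) (hA : A.IsDissipative)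
    (hl : 0 < l) (x : X) : (inner ℂ (yosida l R x) x).re ≤ 0 := by
  have e : yosida l R x = (l : ℂ) • A ⟨R x, hR.mem x⟩ := by
    rw [hR.apply_mk]
    simp [yosida]
  have ex : x = (l : ℂ) • R x - A ⟨R x, hR.mem x⟩ := (hR x).2.symm
  have h := hA ⟨R x, hR.mem x⟩
  rw [e]
  have e2 : inner ℂ (A ⟨R x, hR.mem x⟩) x =
      inner ℂ (A ⟨R x, hR.mem x⟩) ((l : ℂ) • R x - A ⟨R x, hR.mem x⟩) := by rw [← ex]
  rw [inner_smul_left, e2, inner_sub_right, inner_smul_right, inner_self_eq_norm_sq_to_K,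
    Complex.conj_ofReal, Complex.re_ofReal_mul, Complex.sub_re, Complex.re_ofReal_mul]
  simp only [Complex.coe_algebraMap]
  norm_cast
  have h2 := sq_nonneg ‖A ⟨R x, hR.mem x⟩‖
  have h3 := mul_nonneg hl.le (neg_nonneg.2 h)
  have h4 := mul_nonneg hl.le (add_nonneg h2 h3)
  simp only at h4 ⊢
  nlinarith

theorem IsRightResolvent.commute_yosida (hR : A.IsRightResolvent l R)
    (hQ : A.IsRightResolvent m Q) (hA : A.IsDissipative) (hl : 0 < l) (hm : 0 < m) :
    Commute (yosida l R) (yosida m Q) := by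
  have h := hR.commute hQ hA hl hm
  unfold yosida
  exact ((((h.smul_right _).smul_left _).sub_left (Commute.one_left _)).sub_right
    (Commute.one_right _)).smul_right _ |>.smul_left _

theorem IsRightResolvent.yosida_apply (hR : A.IsRightResolvent l R) (hA : A.IsDissipative)
    (hl : 0 < l) (x : A.domain) : yosida l R x = (l : ℂ) • R (A x) := by
  have h := hR.apply_sub hA hl x
  rw [_root_.map_sub, _root_.map_smul, sub_eq_iff_eq_add] at h
  change (l : ℂ) • ((l : ℂ) • R x - x) = _
  rw [h, add_sub_cancel_left]

/-- `l R(l) x → x` as `l → ∞`. -/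
theorem IsDissipative.tendsto_smul_resolvent (hA : A.IsDissipative)
    (hd : Dense (A.domain : Set X)) {l : ℕ → ℝ} (hl : ∀ n, 0 < l n) (hlt : Tendsto l atTop atTop)
    {R : ℕ → X →L[ℂ] X} (hR : ∀ n, A.IsRightResolvent (l n) (R n)) (x : X) :
    Tendsto (fun n => (l n : ℂ) • R n x) atTop (𝓝 x) := by
  have hb (n : ℕ) (y : X) : ‖(l n : ℂ) • R n y‖ ≤ ‖y‖ := by
    rw [norm_smul, Complex.norm_real, Real.norm_of_nonneg (hl n).le]
    calc l n * ‖R n y‖ ≤ l n * ((l n)⁻¹ * ‖y‖) := by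
          gcongr
          · exact (hl n).le
          · exact (R n).le_of_opNorm_le ((hR n).norm_le hA (hl n)) y
      _ = ‖y‖ := by rw [mul_inv_cancel_left₀ (hl n).ne']
  rw [Metric.tendsto_atTop]
  intro ε hε
  obtain ⟨y, hy, hxy⟩ := Metric.dense_iff.1 hd x (ε / 3) (by positivity)
  rw [Metric.mem_ball, dist_comm, dist_eq_norm] at hy
  have ht : Tendsto (fun n => (l n)⁻¹ * ‖A ⟨y, hxy⟩‖) atTop (𝓝 0) := by
    simpa using hlt.inv_tendsto_atTop.mul_const ‖A ⟨y, hxy⟩‖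
  obtain ⟨N, hN⟩ := Filter.eventually_atTop.1
    (ht.eventually (gt_mem_nhds (show 0 < ε / 3 by positivity)))
  refine ⟨N, fun n hn => ?_⟩
  have h1 : (l n : ℂ) • R n y - y = R n (A ⟨y, hxy⟩) := by
    have h := (hR n).apply_sub hA (hl n) ⟨y, hxy⟩
    rw [_root_.map_sub, _root_.map_smul, sub_eq_iff_eq_add] at h
    rw [h]; simp
  have h2 : ‖(l n : ℂ) • R n y - y‖ < ε / 3 := by
    rw [h1]
    exact ((R n).le_of_opNorm_le ((hR n).norm_le hA (hl n)) _).trans_lt (hN n hn)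
  have h3 := hb n (x - y)
  have e : (l n : ℂ) • R n x - x =
      (l n : ℂ) • R n (x - y) + ((l n : ℂ) • R n y - y) + (y - x) := by
    rw [_root_.map_sub, smul_sub]; abel
  rw [dist_eq_norm, e]
  have h4 := norm_add_le ((l n : ℂ) • R n (x - y) + ((l n : ℂ) • R n y - y)) (y - x)
  have h5 := norm_add_le ((l n : ℂ) • R n (x - y)) ((l n : ℂ) • R n y - y)
  rw [norm_sub_rev y x] at h4
  linarith

end Resolvent

end LinearPMap

/-! ### The Lumer–Phillips theorem -/

namespace C0Semigroup

variable {X : Type*} [NormedAddCommGroup X] [InnerProductSpace ℂ X]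

theorem re_inner_le_zero_of_tendsto {S : C0Semigroup X} (hS : S.IsContraction) {x y : X}
    (h : Tendsto (fun t : ℝ≥0 => (((t : ℝ) : ℂ)⁻¹) • (S.toFun t x - x)) (𝓝[>] 0) (𝓝 y)) :
    (inner ℂ y x).re ≤ 0 := by
  -- The difference quotients satisfy `Re ⟪S(t) x - x, x⟫ ≤ ‖S(t) x‖ ‖x‖ - ‖x‖² ≤ 0`.
  have hc : Tendsto (fun t : ℝ≥0 => (inner ℂ ((((t : ℝ) : ℂ)⁻¹) • (S.toFun t x - x)) x).re)
      (𝓝[>] 0) (𝓝 (inner ℂ y x).re) :=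
    (Complex.continuous_re.tendsto _).comp (h.inner tendsto_const_nhds)
  refine le_of_tendsto hc (Eventually.of_forall fun t => ?_)
  rw [inner_smul_left, ← Complex.ofReal_inv, Complex.conj_ofReal, Complex.re_ofReal_mul,
    inner_sub_left, Complex.sub_re, inner_self_eq_norm_sq_to_K]
  have h1 := (Complex.re_le_norm _).trans (norm_inner_le_norm (𝕜 := ℂ) (S.toFun t x) x)
  have h2 : ‖S.toFun t x‖ ≤ ‖x‖ := by simpa using (S.toFun t).le_of_opNorm_le (hS t) x
  have h3 : (((‖x‖ : ℝ) : ℂ) ^ 2).re = ‖x‖ ^ 2 := by norm_cast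
  refine mul_nonpos_of_nonneg_of_nonpos (by positivity) ?_
  simp only [Complex.coe_algebraMap]
  rw [h3]
  nlinarith [norm_nonneg x]

/-- If the generator of a contraction semigroup extends the operator `A`, and `1 - A` is onto, then
it is `A`: generators are dissipative, so `A` has no proper dissipative extension. -/
theorem IsContraction.isGenerator {S : C0Semigroup X} (hS : S.IsContraction) {A : X →ₗ.[ℂ] X}
    (hr : ∀ y, ∃ x : A.domain, (x : X) - A x = y)
    (hA : ∀ x : A.domain, Tendsto (fun t : ℝ≥0 => (((t : ℝ) : ℂ)⁻¹) • (S.toFun t x - (x : X)))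
      (𝓝[>] 0) (𝓝 (A x))) : S.IsGenerator A := by
  intro x y
  rw [LinearPMap.mem_graph_iff]
  constructor
  · rintro ⟨u, rfl, rfl⟩
    exact hA u
  · intro h
    -- `x - u` is in the domain of the generator, which maps it to itself.
    obtain ⟨u, hu⟩ := hr (x - y)
    have hs : Tendsto (fun t : ℝ≥0 => (((t : ℝ) : ℂ)⁻¹) • (S.toFun t (x - u) - (x - u)))
        (𝓝[>] 0) (𝓝 (y - A u)) := by
      refine (h.sub (hA u)).congr fun t => ?_
      rw [map_sub, ← smul_sub]
      congr 1
      abel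
    have e : y - A u = x - u := by
      rw [sub_eq_sub_iff_add_eq_add]
      rw [sub_eq_sub_iff_add_eq_add] at hu
      rw [← add_comm (u : X), hu, add_comm]
    have h0 := re_inner_le_zero_of_tendsto hS hs
    rw [e, inner_self_eq_norm_sq_to_K] at h0
    have h3 : (((‖x - u‖ : ℝ) : ℂ) ^ 2).re = ‖x - u‖ ^ 2 := by norm_cast
    simp only [Complex.coe_algebraMap] at h0
    rw [h3] at h0
    have h4 : x - u = 0 := by
      have : ‖x - u‖ = 0 := by nlinarith [norm_nonneg (x - u)]
      exact norm_eq_zero.1 this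
    refine ⟨u, (sub_eq_zero.1 h4).symm, ?_⟩
    rw [h4] at e
    exact (sub_eq_zero.1 e).symm

end C0Semigroup

/-- The Lumer–Phillips theorem in a Hilbert space. The semigroup is the limit of the exponentials of
the Yosida approximations. -/
theorem LinearPMap.IsDissipative.exists_c0Semigroup {X : Type*} [NormedAddCommGroup X]
    [InnerProductSpace ℂ X] [CompleteSpace X] {A : X →ₗ.[ℂ] X} (hA : A.IsDissipative)
    (hr : ∀ y, ∃ x : A.domain, (x : X) - A x = y) :
    ∃ S : C0Semigroup X, S.IsContraction ∧ S.IsGenerator A := by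
  choose R hR using hA.exists_isRightResolvent_pow hr
  have hd := hA.dense_domain hr
  set l : ℕ → ℝ := fun n => (3 / 2 : ℝ) ^ n with hl
  have hl0 (n : ℕ) : 0 < l n := by positivity
  have hlt : Tendsto l atTop atTop := tendsto_pow_atTop_atTop_of_one_lt (by norm_num)
  set Y : ℕ → X →L[ℂ] X := fun n => yosida (l n) (R n) with hY
  have hYd (n : ℕ) (x : X) : (inner ℂ (Y n x) x).re ≤ 0 := (hR n).re_inner_yosida_le hA (hl0 n) x
  have hYc (n k : ℕ) : Commute (Y n) (Y k) :=
    (hR n).commute_yosida (hR k) hA (hl0 n) (hl0 k)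
  have hYt (x : A.domain) : Tendsto (fun n => Y n x) atTop (𝓝 (A x)) :=
    (hA.tendsto_smul_resolvent hd hl0 hlt hR (A x)).congr fun n =>
      ((hR n).yosida_apply hA (hl0 n) x).symm
  set T : ℕ → ℝ≥0 → X →L[ℂ] X := fun n t => NormedSpace.exp ((t : ℝ) • Y n) with hT
  have hTn (n : ℕ) (t : ℝ≥0) (x : X) : ‖T n t x‖ ≤ ‖x‖ := norm_exp_smul_apply_le (hYd n) t.2 x
  have hTd (n k : ℕ) (t : ℝ≥0) (x : X) : ‖T n t x - T k t x‖ ≤ t * ‖Y n x - Y k x‖ :=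
    norm_exp_smul_sub_exp_smul_le (hYd n) (hYd k) (hYc n k) t.2 x
  -- On the domain the approximants converge with the Yosida approximations; elsewhere by density.
  have hcauchy (t : ℝ≥0) (x : X) : CauchySeq fun n => T n t x := by
    rw [Metric.cauchySeq_iff]
    intro ε hε
    obtain ⟨y, hy, hxy⟩ := Metric.dense_iff.1 hd x (ε / 3) (by positivity)
    rw [Metric.mem_ball, dist_comm, dist_eq_norm] at hy
    have hc := (hYt ⟨y, hxy⟩).cauchySeq
    rw [Metric.cauchySeq_iff] at hc
    obtain ⟨N, hN⟩ := hc (ε / (3 * (t + 1))) (by positivity)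
    refine ⟨N, fun n hn k hk => ?_⟩
    have h1 := hN n hn k hk
    rw [dist_eq_norm, lt_div_iff₀ (by positivity)] at h1
    have h2 := hTd n k t y
    have h3 := hTn n t (x - y)
    have h4 := hTn k t (y - x)
    rw [norm_sub_rev y x] at h4
    have e : T n t x - T k t x = T n t (x - y) + (T n t y - T k t y) + T k t (y - x) := by
      rw [_root_.map_sub, _root_.map_sub]; abel
    rw [dist_eq_norm, e]
    have h5 := norm_add_le (T n t (x - y) + (T n t y - T k t y)) (T k t (y - x))
    have h6 := norm_add_le (T n t (x - y)) (T n t y - T k t y)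
    have h7 := norm_nonneg (Y n y - Y k y)
    simp only at h1
    linarith
  choose L hL using fun t x => cauchySeq_tendsto_of_complete (hcauchy t x)
  have hL' (t : ℝ≥0) : Tendsto (fun n x => T n t x) atTop (𝓝 (L t)) :=
    tendsto_pi_nhds.2 (hL t)
  have hLn (t : ℝ≥0) (x : X) : ‖L t x‖ ≤ ‖x‖ :=
    le_of_tendsto (hL t x).norm (Eventually.of_forall fun n => hTn n t x)
  have hLid (t : ℝ≥0) (x : A.domain) : ‖L t x - x‖ ≤ t * ‖A x‖ :=
    le_of_tendsto_of_tendsto' ((hL t x).sub_const _).norm ((hYt x).norm.const_mul _)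
      fun n => norm_exp_smul_sub_le (hYd n) t.2 _
  have hLT (t : ℝ≥0) (n : ℕ) (x : A.domain) : ‖L t x - T n t x‖ ≤ t * ‖A x - Y n x‖ :=
    le_of_tendsto_of_tendsto' ((hL t x).sub_const _).norm
      (((hYt x).sub_const _).norm.const_mul _) fun k => hTd k n t x
  let S : C0Semigroup X :=
    { toFun := fun t => continuousLinearMapOfTendsto (fun n => T n t) (hL' t)
      map_zero := by
        ext x
        change L 0 x = x
        refine tendsto_nhds_unique (hL 0 x) ?_
        simp [hT]
      map_add := fun s t => by
        ext x
        change L (s + t) x = L s (L t x)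
        refine tendsto_nhds_unique (hL (s + t) x) ?_
        have h1 : Tendsto (fun n => T n s (T n t x) - T n s (L t x)) atTop (𝓝 0) := by
          have h0 : Tendsto (fun n => ‖T n t x - L t x‖) atTop (𝓝 0) := by
            simpa using ((hL t x).sub_const (L t x)).norm
          refine squeeze_zero_norm (fun n => ?_) h0
          rw [← _root_.map_sub]
          exact hTn n s _
        have h2 := h1.add (hL s (L t x))
        rw [zero_add] at h2
        refine h2.congr fun n => ?_
        have : T n (s + t) = T n s * T n t := by
          have hc : Commute ((s : ℝ) • Y n) ((t : ℝ) • Y n) :=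
            ((Commute.refl (Y n)).smul_left _).smul_right _
          simp only [hT, NNReal.coe_add, add_smul]
          let _ : NormedAlgebra ℚ (X →L[ℂ] X) := NormedAlgebra.restrictScalars ℚ ℝ _
          exact NormedSpace.exp_add_of_commute hc
        rw [this]
        simp
      tendsto_zero := fun x => by
        change Tendsto (fun t => L t x) (𝓝 0) (𝓝 x)
        rw [Metric.tendsto_nhds]
        intro ε hε
        obtain ⟨y, hy, hxy⟩ := Metric.dense_iff.1 hd x (ε / 3) (by positivity)
        rw [Metric.mem_ball, dist_comm, dist_eq_norm] at hy
        have ht : Tendsto (fun t : ℝ≥0 => (t : ℝ) * ‖A ⟨y, hxy⟩‖) (𝓝 0) (𝓝 0) := by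
          have : Continuous fun t : ℝ≥0 => (t : ℝ) * ‖A ⟨y, hxy⟩‖ := by fun_prop
          simpa using this.tendsto 0
        filter_upwards [ht.eventually (gt_mem_nhds (show 0 < ε / 3 by positivity))] with t h1
        have h2 := hLid t ⟨y, hxy⟩
        simp only at h2
        have hsub : L t (x - y) = L t x - L t y :=
          _root_.map_sub (continuousLinearMapOfTendsto (fun n => T n t) (hL' t)) x y
        have h3 := hLn t (x - y)
        have e : L t x - x = L t (x - y) + (L t y - y) + (y - x) := by rw [hsub]; abel
        rw [dist_eq_norm, e]
        have h4 := norm_add_le (L t (x - y) + (L t y - y)) (y - x)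
        have h5 := norm_add_le (L t (x - y)) (L t y - y)
        rw [norm_sub_rev y x] at h4
        linarith }
  have hS : S.IsContraction := fun t =>
    ContinuousLinearMap.opNorm_le_bound _ zero_le_one fun x => by
      rw [one_mul]; exact hLn t x
  refine ⟨S, hS, hS.isGenerator hr fun x => ?_⟩
  -- The difference quotient of `S` is within `‖A x - Y n x‖` of that of `exp(t Y n)`, uniformly in `t`.
  rw [Metric.tendsto_nhds]
  intro ε hε
  obtain ⟨n, hn⟩ := (Metric.tendsto_atTop.1 (hYt x) (ε / 3) (by positivity))
  have hn := hn n le_rfl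
  rw [dist_eq_norm, norm_sub_rev] at hn
  have hder : HasDerivAt (fun s : ℝ => NormedSpace.exp (s • Y n) (x : X)) (Y n x) 0 := by
    simpa using (hasDerivAt_exp_smul_const (Y n) (0 : ℝ)).clm_apply_const (x : X)
  have hslope := (hasDerivAt_iff_tendsto_slope_zero.1 hder)
  have hcoe : Tendsto (fun t : ℝ≥0 => (t : ℝ)) (𝓝[>] 0) (𝓝[≠] 0) := by
    refine tendsto_nhdsWithin_iff.2 ⟨?_, ?_⟩
    · have : Continuous fun t : ℝ≥0 => (t : ℝ) := by fun_prop
      exact (this.tendsto 0).mono_left nhdsWithin_le_nhds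
    · filter_upwards [self_mem_nhdsWithin] with t ht
      exact (NNReal.coe_pos.2 ht).ne'
  have hev := (Metric.tendsto_nhds.1 (hslope.comp hcoe)) (ε / 3) (by positivity)
  filter_upwards [hev, self_mem_nhdsWithin] with t h1 ht
  have ht0 : (0 : ℝ) < t := ht
  simp only [Function.comp_apply, zero_add, zero_smul, NormedSpace.exp_zero,
    one_apply_eq_self, dist_eq_norm] at h1
  rw [← Complex.coe_smul, Complex.ofReal_inv] at h1
  have h2 : ‖(((t : ℝ) : ℂ)⁻¹) • (L t x - T n t x)‖ ≤ ‖A x - Y n x‖ := by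
    rw [norm_smul, norm_inv, Complex.norm_real, Real.norm_of_nonneg ht0.le, inv_mul_le_iff₀ ht0]
    exact hLT t n x
  have e : (((t : ℝ) : ℂ)⁻¹) • (L t x - x) - A x =
      (((t : ℝ) : ℂ)⁻¹) • (L t x - T n t x) + ((((t : ℝ) : ℂ)⁻¹) • (T n t x - x) - Y n x)
        + (Y n x - A x) := by
    simp only [smul_sub]; abel
  change dist ((((t : ℝ) : ℂ)⁻¹) • (L t x - x)) (A x) < ε
  rw [dist_eq_norm, e]
  have h4 := norm_add_le ((((t : ℝ) : ℂ)⁻¹) • (L t x - T n t x)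
    + ((((t : ℝ) : ℂ)⁻¹) • (T n t x - x) - Y n x)) (Y n x - A x)
  have h5 := norm_add_le ((((t : ℝ) : ℂ)⁻¹) • (L t x - T n t x))
    ((((t : ℝ) : ℂ)⁻¹) • (T n t x - x) - Y n x)
  rw [norm_sub_rev (Y n x)] at h4
  linarith

/-! ### One-dimensional Sobolev spaces -/

section Sobolev

variable {a b : ℝ}

/-- Fubini's theorem on the triangle `a < t ≤ x < b`. -/
theorem integral_mul_primitive {f g : ℝ → ℂ} (hf : IntegrableOn f (Ioo a b))
    (hg : IntegrableOn g (Ioo a b)) :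
    ∫ x in Ioo a b, f x * ∫ t in a..x, g t =
      ∫ t in Ioo a b, g t * ((∫ x in Ioo a b, f x) - ∫ x in a..t, f x) := by
  have hint : Integrable (fun z : ℝ × ℝ => f z.1 * g z.2)
      ((volume.restrict (Ioo a b)).prod (volume.restrict (Ioo a b))) := hf.mul_prod hg
  have hS : MeasurableSet {z : ℝ × ℝ | z.2 ≤ z.1} := measurableSet_le measurable_snd measurable_fst
  have L : ∫ x in Ioo a b, f x * ∫ t in a..x, g t =
      ∫ x in Ioo a b, ∫ t in Ioo a b,
        {z : ℝ × ℝ | z.2 ≤ z.1}.indicator (fun z : ℝ × ℝ => f z.1 * g z.2) (x, t) := by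
    refine setIntegral_congr_fun measurableSet_Ioo fun x hx => ?_
    have : (fun t => {z : ℝ × ℝ | z.2 ≤ z.1}.indicator (fun z : ℝ × ℝ => f z.1 * g z.2) (x, t))
        = (Iic x).indicator (fun t => f x * g t) := by
      ext t; simp [indicator]
    rw [this, setIntegral_indicator measurableSet_Iic, integral_const_mul,
      intervalIntegral.integral_of_le hx.1.le]
    congr 3
    ext t; simp only [mem_Ioc, mem_inter_iff, mem_Ioo, mem_Iic]
    exact ⟨fun h => ⟨⟨h.1, h.2.trans_lt hx.2⟩, h.2⟩, fun h => ⟨h.1.1, h.2⟩⟩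
  rw [L, integral_integral_swap (f := fun x t => {z : ℝ × ℝ | z.2 ≤ z.1}.indicator
    (fun z : ℝ × ℝ => f z.1 * g z.2) (x, t)) (hint.indicator hS)]
  refine setIntegral_congr_fun measurableSet_Ioo fun t ht => ?_
  have : (fun x => {z : ℝ × ℝ | z.2 ≤ z.1}.indicator (fun z : ℝ × ℝ => f z.1 * g z.2) (x, t))
        = (Ici t).indicator (fun x => f x * g t) := by
      ext t; simp [indicator]
  rw [this, setIntegral_indicator measurableSet_Ici, integral_mul_const, mul_comm]
  congr 1
  have e : Ioo a b ∩ Ici t = Ico t b := by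
    ext x; simp only [mem_Ico, mem_inter_iff, mem_Ioo, mem_Ici]
    exact ⟨fun h => ⟨h.2, h.1.2⟩, fun h => ⟨⟨ht.1.trans_le h.1, h.2⟩, h.1⟩⟩
  have e' : Ioo a b = Ioo a t ∪ Ico t b := (Ioo_union_Ico_eq_Ioo ht.1 ht.2.le).symm
  have hd : Disjoint (Ioo a t) (Ico t b) :=
    disjoint_left.2 fun x hx hx' => absurd hx.2 (not_lt.2 hx'.1)
  rw [e, intervalIntegral.integral_of_le ht.1.le, integral_Ioc_eq_integral_Ioo, e',
    setIntegral_union hd measurableSet_Ico (hf.mono_set (e' ▸ subset_union_left))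
    (hf.mono_set (e' ▸ subset_union_right)), add_sub_cancel_left]

/-- Integration by parts in `H¹(a, b)`, by `integral_mul_primitive` for the representations
`u = c + ∫ u'` and `w = d + ∫ w'`. -/
theorem HasWeakDeriv.inner_add_inner (hab : a < b) {u u' w w' : IntervalL2 a b}
    (hu : HasWeakDeriv u u') (hw : HasWeakDeriv w w') :
    inner ℂ u' w + inner ℂ u w' =
      (starRingEnd ℂ) (pointValue u b) * pointValue w b
        - (starRingEnd ℂ) (pointValue u a) * pointValue w a := by
  obtain ⟨c, hc⟩ := hu.exists_isContinuousRep hab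
  obtain ⟨d, hd⟩ := hw.exists_isContinuousRep hab
  rw [hc.pointValue_eq hab (right_mem_Icc.2 hab.le), hc.pointValue_eq hab (left_mem_Icc.2 hab.le),
    hd.pointValue_eq hab (right_mem_Icc.2 hab.le), hd.pointValue_eq hab (left_mem_Icc.2 hab.le)]
  have hI (y : IntervalL2 a b) : ContinuousOn (fun x => ∫ t in a..x, y t) (Icc a b) :=
    intervalIntegral.continuousOn_primitive_interval (by
      rw [uIcc_of_le hab.le, integrableOn_Icc_iff_integrableOn_Ioo]; exact y.integrableOn)
      |>.mono (by rw [uIcc_of_le hab.le])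
  have hconj : IntegrableOn (fun x => (starRingEnd ℂ) (u' x)) (Ioo a b) :=
    (Complex.conjLIE.toContinuousLinearEquiv.toContinuousLinearMap).integrable_comp u'.integrableOn
  have hprod {f F : ℝ → ℂ} (hf : IntegrableOn f (Ioo a b)) (hF : ContinuousOn F (Icc a b)) :
      IntegrableOn (fun x => f x * F x) (Ioo a b) := by
    have h1 : IntegrableOn f (Icc a b) := by rwa [integrableOn_Icc_iff_integrableOn_Ioo]
    exact (h1.mul_continuousOn hF isCompact_Icc).mono_set Ioo_subset_Icc_self
  have hcF (x : ℝ) : (starRingEnd ℂ) (∫ t in a..x, u' t) = ∫ t in a..x, (starRingEnd ℂ) (u' t) := by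
    simp only [intervalIntegral, map_sub, integral_conj]
  have hF : ContinuousOn (fun x => ∫ t in a..x, (starRingEnd ℂ) (u' t)) (Icc a b) :=
    (Complex.continuous_conj.comp_continuousOn (hI u')).congr fun x _ => (hcF x).symm
  have e1 : inner ℂ u' w = d * (∫ x in Ioo a b, (starRingEnd ℂ) (u' x)) +
      ∫ x in Ioo a b, (starRingEnd ℂ) (u' x) * ∫ t in a..x, w' t := by
    rw [L2.inner_def, ← integral_const_mul, ← integral_add (hconj.const_mul d) (hprod hconj (hI w'))]
    refine integral_congr_ae ?_
    filter_upwards [hd.2] with x hx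
    rw [RCLike.inner_apply, hx]
    ring
  have e2 : inner ℂ u w' = (starRingEnd ℂ) c * (∫ x in Ioo a b, w' x) +
      ∫ x in Ioo a b, w' x * ∫ t in a..x, (starRingEnd ℂ) (u' t) := by
    rw [L2.inner_def, ← integral_const_mul, ← integral_add (w'.integrableOn.const_mul _)
      (hprod w'.integrableOn hF)]
    refine integral_congr_ae ?_
    filter_upwards [hc.2] with x hx
    rw [RCLike.inner_apply, hx, map_add, hcF]
    ring
  have e3 : ∫ t in Ioo a b, w' t * ((∫ x in Ioo a b, (starRingEnd ℂ) (u' x)) -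
        ∫ x in a..t, (starRingEnd ℂ) (u' x)) =
      (∫ t in Ioo a b, w' t) * (∫ x in Ioo a b, (starRingEnd ℂ) (u' x)) -
        ∫ t in Ioo a b, w' t * ∫ x in a..t, (starRingEnd ℂ) (u' x) := by
    simp_rw [mul_sub]
    rw [integral_sub (w'.integrableOn.mul_const _) (hprod w'.integrableOn hF), integral_mul_const]
  rw [e1, e2, integral_mul_primitive hconj w'.integrableOn, e3]
  simp only [intervalIntegral.integral_same, add_zero, map_add, hcF]
  rw [intervalIntegral.integral_of_le hab.le, intervalIntegral.integral_of_le hab.le,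
    integral_Ioc_eq_integral_Ioo, integral_Ioc_eq_integral_Ioo]
  ring

theorem HasWeakDeriv.mem {u w : IntervalL2 a b} (h : HasWeakDeriv u w) : u ∈ SobolevH1 a b := ⟨w, h⟩

theorem HasWeakDeriv.sub {u u' w w' : IntervalL2 a b} (h : HasWeakDeriv u w)
    (h' : HasWeakDeriv u' w') : HasWeakDeriv (u - u') (w - w') := by
  simpa [sub_eq_add_neg] using h.add (h'.smul (-1))

theorem weakDeriv_sub {u u' : IntervalL2 a b} (h : u ∈ SobolevH1 a b) (h' : u' ∈ SobolevH1 a b) :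
    weakDeriv (u - u') = weakDeriv u - weakDeriv u' :=
  ((hasWeakDeriv_weakDeriv h).sub (hasWeakDeriv_weakDeriv h')).weakDeriv_eq

theorem pointValue_sub (hab : a < b) {u u' : IntervalL2 a b} (h : u ∈ SobolevH1 a b)
    (h' : u' ∈ SobolevH1 a b) {x : ℝ} (hx : x ∈ Icc a b) :
    pointValue (u - u') x = pointValue u x - pointValue u' x := by
  rw [sub_eq_add_neg, ← neg_one_smul ℂ u', pointValue_add hab h (Submodule.smul_mem _ _ h') hx,
    pointValue_smul hab _ h' hx]
  ring

/-- Primitives of `L²` functions, with prescribed value at the left end point. -/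
theorem exists_hasWeakDeriv (hab : a < b) (w : IntervalL2 a b) (c : ℂ) :
    ∃ u, HasWeakDeriv u w ∧ IsContinuousRep u fun x => c + ∫ t in a..x, w t := by
  have hI : ContinuousOn (fun x => c + ∫ t in a..x, w t) (Icc a b) :=
    continuousOn_const.add <| intervalIntegral.continuousOn_primitive_interval (by
      rw [uIcc_of_le hab.le, integrableOn_Icc_iff_integrableOn_Ioo]; exact w.integrableOn)
      |>.mono (by rw [uIcc_of_le hab.le])
  obtain ⟨C, hC⟩ := isCompact_Icc.exists_bound_of_continuousOn hI
  have hm : MemLp (fun x => c + ∫ t in a..x, w t) 2 (volume.restrict (Ioo a b)) := by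
    refine MemLp.of_bound ((hI.mono Ioo_subset_Icc_self).aestronglyMeasurable measurableSet_Ioo) C ?_
    filter_upwards [ae_restrict_mem measurableSet_Ioo] with x hx
    exact hC x (Ioo_subset_Icc_self hx)
  refine ⟨hm.toLp _, fun g hg => ?_, hI, hm.coeFn_toLp⟩
  have h0 : ∫ x in Ioo a b, deriv g x • c = 0 := by
    have ga : g a = 0 := by
      by_contra h
      exact lt_irrefl a (hg.tsupport_subset (subset_tsupport g h)).1
    rw [integral_smul_const, ← integral_Ioc_eq_integral_Ioo,
      ← intervalIntegral.integral_of_le hab.le,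
      intervalIntegral.integral_eq_sub_of_hasDerivAt (fun x _ => hg.hasDerivAt x)
      (hg.continuous_deriv.intervalIntegrable _ _), hg.eq_zero_right, ga, sub_zero, zero_smul]
  have hI' : IntegrableOn (fun x => ∫ t in a..x, w t) (Ioo a b) := by
    simpa using ((hI.sub continuousOn_const).integrableOn_Icc (μ := volume)).mono_set
      (Ioo_subset_Icc_self (a := a) (b := b)) |>.congr_fun (fun x _ => add_sub_cancel_left c _)
        measurableSet_Ioo
  rw [← integral_deriv_smul_primitive w.integrableOn hg,
    ← zero_add (∫ x in Ioo a b, deriv g x • ∫ t in a..x, w t), ← h0,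
    ← integral_add (hg.integrableOn_deriv_smul (integrableOn_const (by simp)))
      (hg.integrableOn_deriv_smul hI')]
  refine integral_congr_ae ?_
  filter_upwards [hm.coeFn_toLp] with x hx
  rw [hx, smul_add]

theorem exists_hasWeakDeriv_pointValue_right (hab : a < b) (w : IntervalL2 a b) (c : ℂ) :
    ∃ u, HasWeakDeriv u w ∧ pointValue u b = c := by
  obtain ⟨u, hu, hc⟩ := exists_hasWeakDeriv hab w (c - ∫ t in a..b, w t)
  refine ⟨u, hu, ?_⟩
  rw [hc.pointValue_eq hab (right_mem_Icc.2 hab.le), sub_add_cancel]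

/-- The affine function with prescribed boundary values. -/
theorem exists_pointValue_eq (hab : a < b) (c d : ℂ) :
    ∃ u ∈ SobolevH1 a b, pointValue u a = c ∧ pointValue u b = d := by
  have hm : MemLp (fun _ : ℝ => (d - c) / ((b - a : ℝ) : ℂ)) 2 (volume.restrict (Ioo a b)) :=
    memLp_const _
  obtain ⟨u, hu, hc⟩ := exists_hasWeakDeriv hab (hm.toLp _) c
  refine ⟨u, hu.mem, ?_, ?_⟩
  · rw [hc.pointValue_eq hab (left_mem_Icc.2 hab.le), intervalIntegral.integral_same, add_zero]
  · have h0 : ((b - a : ℝ) : ℂ) ≠ 0 := Complex.ofReal_ne_zero.2 (sub_pos.2 hab).ne'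
    rw [hc.pointValue_eq hab (right_mem_Icc.2 hab.le), intervalIntegral.integral_of_le hab.le,
      integral_Ioc_eq_integral_Ioo, integral_congr_ae hm.coeFn_toLp, integral_const]
    simp only [measureReal_restrict_apply_univ, Real.volume_real_Ioo_of_le hab.le,
      ← Complex.coe_smul, smul_eq_mul]
    field_simp
    ring

/-- The trace at an end point is continuous for the graph norm of the weak derivative. -/
theorem exists_pointValue_right_eq_inner (hab : a < b) :
    ∃ e e' : IntervalL2 a b, ∀ u w, HasWeakDeriv u w →
      pointValue u b = inner ℂ e' u + inner ℂ e w := by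
  obtain ⟨e, he, h0, h1⟩ := exists_pointValue_eq hab 0 1
  refine ⟨e, weakDeriv e, fun u w h => ?_⟩
  rw [(hasWeakDeriv_weakDeriv he).inner_add_inner hab h, h0, h1]
  simp

theorem exists_pointValue_left_eq_inner (hab : a < b) :
    ∃ e e' : IntervalL2 a b, ∀ u w, HasWeakDeriv u w →
      pointValue u a = inner ℂ e' u + inner ℂ e w := by
  obtain ⟨e, he, h0, h1⟩ := exists_pointValue_eq hab (-1) 0
  refine ⟨e, weakDeriv e, fun u w h => ?_⟩
  rw [(hasWeakDeriv_weakDeriv he).inner_add_inner hab h, h0, h1]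
  simp

theorem isClosed_hasWeakDeriv : IsClosed {q : IntervalL2 a b × IntervalL2 a b |
    HasWeakDeriv q.1 q.2} := by
  have hc {g : ℝ → ℝ} (h1 : Continuous g) (h2 : HasCompactSupport g) :
      Continuous fun u : IntervalL2 a b => ∫ x in Ioo a b, g x • u x := by
    obtain ⟨C, hC⟩ := h2.exists_bound_of_continuous h1
    have hm : MemLp (fun x => (g x : ℂ)) 2 (volume.restrict (Ioo a b)) :=
      MemLp.of_bound (by fun_prop) C (Eventually.of_forall fun x => by simpa using hC x)
    have e (u : IntervalL2 a b) : ∫ x in Ioo a b, g x • u x = inner ℂ (hm.toLp _) u := by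
      rw [L2.inner_def]
      refine integral_congr_ae ?_
      filter_upwards [hm.coeFn_toLp] with x hx
      rw [hx, RCLike.inner_apply, Complex.conj_ofReal, Complex.real_smul, mul_comm]
    simp_rw [e]
    fun_prop
  simp only [HasWeakDeriv, ofPred_forall]
  refine isClosed_iInter fun g => isClosed_iInter fun hg => isClosed_eq ?_ ?_
  · exact (hc hg.continuous_deriv hg.hasCompactSupport.deriv).comp continuous_fst
  · exact ((hc hg.contDiff.continuous hg.hasCompactSupport).comp continuous_snd).neg

end Sobolev

/-! ### Completeness of the energy space -/

theorem IntervalL2.ofReal_smul {a b : ℝ} (r : ℝ) (u : IntervalL2 a b) : (r : ℂ) • u = r • u :=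
  algebraMap_smul ℂ r u

theorem norm_le_of_mul_sq_le {E : Type*} [NormedAddCommGroup E] {c r : ℝ} {x : E} (hc : 0 < c)
    (hr : 0 ≤ r) (h : c * ‖x‖ ^ 2 ≤ r ^ 2) : ‖x‖ ≤ (√c)⁻¹ * r := by
  have hs : 0 < √c := Real.sqrt_pos.2 hc
  rw [inv_mul_eq_div, le_div_iff₀ hs]
  refine le_of_sq_le_sq ?_ hr
  rw [mul_pow, Real.sq_sqrt hc.le]
  linarith

namespace SystemParams.EnergySpace

variable {par : SystemParams}

theorem χ₁_pos (par : SystemParams) : 0 < par.χ₁ := par.χ₁_pos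

/-- The linear map `(z, v, V, p, P, φ) ↦ (z, v_x, V, p_x, P, φ)`. -/
noncomputable def weakDerivs (par : SystemParams) : par.EnergySpace →ₗ[ℂ]
    IntervalL2 (-par.ℓ₁) 0 × IntervalL2 0 par.ℓ₂ × IntervalL2 0 par.ℓ₂ × IntervalL2 0 par.ℓ₂ ×
      IntervalL2 0 par.ℓ₂ × Lp (IntervalL2 0 par.ℓ₂) 2 (volume : Measure ℝ) where
  toFun U := (U.z, weakDeriv U.v, U.V, weakDeriv U.p, U.P, U.φ)
  map_add' U W := by
    simp only [add_z, add_v, add_V, add_p, add_P, add_φ, weakDeriv_add U.v_mem.1 W.v_mem.1,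
      weakDeriv_add U.p_mem.1 W.p_mem.1, Prod.mk_add_mk]
  map_smul' c U := by
    simp only [smul_z, smul_v, smul_V, smul_p, smul_P, smul_φ, weakDeriv_smul c U.v_mem.1,
      weakDeriv_smul c U.p_mem.1, Prod.smul_mk, RingHom.id_apply]

theorem weakDerivs_bijective : Function.Bijective (weakDerivs par) := by
  constructor
  · rw [injective_iff_map_eq_zero]
    intro U h
    simp only [weakDerivs, LinearMap.coe_mk, AddHom.coe_mk, Prod.mk_eq_zero] at h
    exact EnergySpace.ext h.1 (eq_zero_of_weakDeriv_eq_zero _ U.v_mem h.2.1) h.2.2.1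
      (eq_zero_of_weakDeriv_eq_zero _ U.p_mem h.2.2.2.1) h.2.2.2.2.1 h.2.2.2.2.2
  · rintro ⟨z, v', V, p', P, φ⟩
    obtain ⟨v, hv, hv0⟩ := exists_hasWeakDeriv_pointValue_right par.ℓ₂_pos v' 0
    obtain ⟨p, hp, hp0⟩ := exists_hasWeakDeriv_pointValue_right par.ℓ₂_pos p' 0
    refine ⟨mk z ⟨v, hv.mem, hv0⟩ V ⟨p, hp.mem, hp0⟩ P φ, ?_⟩
    change (z, weakDeriv v, V, weakDeriv p, P, φ) = _
    rw [hv.weakDeriv_eq, hp.weakDeriv_eq]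

theorem exists_norm_weakDerivs_le (par : SystemParams) :
    ∃ C, ∀ U : par.EnergySpace, ‖weakDerivs par U‖ ≤ C * ‖U‖ := by
  have hχ := χ₁_pos par
  have hρ := par.ρ_pos
  have hm := par.mag_pos
  have hβ := par.β_pos
  have hC := par.fracConst_pos
  refine ⟨1 + (1 + |par.γ|) * (√par.χ₁)⁻¹ + (√par.ρ)⁻¹ + (√par.mag)⁻¹ + (√par.β)⁻¹
    + (√par.fracConst)⁻¹, fun U => ?_⟩
  have h := norm_sq U
  have n1 := sq_nonneg ‖U.z‖
  have n2 := mul_nonneg hχ.le (sq_nonneg ‖weakDeriv U.v‖)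
  have n3 := mul_nonneg hρ.le (sq_nonneg ‖U.V‖)
  have n4 := mul_nonneg hm.le (sq_nonneg ‖U.P‖)
  have n5 := mul_nonneg hβ.le (sq_nonneg ‖(par.γ : ℂ) • weakDeriv U.v - weakDeriv U.p‖)
  have n6 := mul_nonneg hC.le (sq_nonneg ‖U.φ‖)
  have hU := norm_nonneg U
  have b1 : ‖U.z‖ ≤ ‖U‖ := le_of_sq_le_sq (by linarith) hU
  have b2 := norm_le_of_mul_sq_le (x := weakDeriv U.v) hχ hU (by linarith)
  have b3 := norm_le_of_mul_sq_le (x := U.V) hρ hU (by linarith)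
  have b4 := norm_le_of_mul_sq_le (x := U.P) hm hU (by linarith)
  have b5 := norm_le_of_mul_sq_le (x := (par.γ : ℂ) • weakDeriv U.v - weakDeriv U.p) hβ hU
    (by linarith)
  have b6 := norm_le_of_mul_sq_le (x := U.φ) hC hU (by linarith)
  have b7 : ‖weakDeriv U.p‖ ≤ |par.γ| * ((√par.χ₁)⁻¹ * ‖U‖) + (√par.β)⁻¹ * ‖U‖ := by
    have e : weakDeriv U.p = (par.γ : ℂ) • weakDeriv U.v
      - ((par.γ : ℂ) • weakDeriv U.v - weakDeriv U.p) := by abel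
    rw [e]
    refine (norm_sub_le _ _).trans (add_le_add ?_ b5)
    rw [norm_smul, Complex.norm_real, Real.norm_eq_abs]
    gcongr
  have p2 : 0 ≤ (√par.χ₁)⁻¹ * ‖U‖ := by positivity
  have p3 : 0 ≤ (√par.ρ)⁻¹ * ‖U‖ := by positivity
  have p4 : 0 ≤ (√par.mag)⁻¹ * ‖U‖ := by positivity
  have p5 : 0 ≤ (√par.β)⁻¹ * ‖U‖ := by positivity
  have p6 : 0 ≤ (√par.fracConst)⁻¹ * ‖U‖ := by positivity
  have p7 : 0 ≤ |par.γ| * ((√par.χ₁)⁻¹ * ‖U‖) := by positivity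
  have e : (1 + (1 + |par.γ|) * (√par.χ₁)⁻¹ + (√par.ρ)⁻¹ + (√par.mag)⁻¹ + (√par.β)⁻¹
      + (√par.fracConst)⁻¹) * ‖U‖ = ‖U‖ + (√par.χ₁)⁻¹ * ‖U‖ + |par.γ| * ((√par.χ₁)⁻¹ * ‖U‖)
        + (√par.ρ)⁻¹ * ‖U‖ + (√par.mag)⁻¹ * ‖U‖ + (√par.β)⁻¹ * ‖U‖
        + (√par.fracConst)⁻¹ * ‖U‖ := by ring
  rw [e]
  simp only [weakDerivs, LinearMap.coe_mk, AddHom.coe_mk, norm_prod_le_iff]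
  refine ⟨?_, ?_, ?_, ?_, ?_, ?_⟩ <;> linarith

theorem exists_norm_le_weakDerivs (par : SystemParams) :
    ∃ C, ∀ U : par.EnergySpace, ‖U‖ ≤ C * ‖weakDerivs par U‖ := by
  have hχ := χ₁_pos par
  have hρ := par.ρ_pos
  have hm := par.mag_pos
  have hβ := par.β_pos
  have hC := par.fracConst_pos
  refine ⟨√(1 + par.χ₁ + par.ρ + par.mag + par.β * (|par.γ| + 1) ^ 2 + par.fracConst),
    fun U => ?_⟩
  set r := ‖weakDerivs par U‖ with hr
  have hr0 : 0 ≤ r := norm_nonneg _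
  have hb := hr.ge
  simp only [weakDerivs, LinearMap.coe_mk, AddHom.coe_mk, norm_prod_le_iff] at hb
  obtain ⟨b1, b2, b3, b4, b5, b6⟩ := hb
  refine le_of_sq_le_sq ?_ (by positivity)
  rw [mul_pow, Real.sq_sqrt (by positivity), norm_sq]
  have b7 : ‖(par.γ : ℂ) • weakDeriv U.v - weakDeriv U.p‖ ≤ (|par.γ| + 1) * r := by
    refine (norm_sub_le _ _).trans ?_
    rw [norm_smul, Complex.norm_real, Real.norm_eq_abs, add_mul, one_mul]
    gcongr
  have e : (1 + par.χ₁ + par.ρ + par.mag + par.β * (|par.γ| + 1) ^ 2 + par.fracConst) * r ^ 2 =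
    r ^ 2 + par.χ₁ * r ^ 2 + par.ρ * r ^ 2 + par.mag * r ^ 2
      + par.β * ((|par.γ| + 1) * r) ^ 2 + par.fracConst * r ^ 2 := by ring
  rw [e]
  gcongr

/-- The energy norm is equivalent to the product norm of `(z, v_x, V, p_x, P, φ)`, which ranges over
a product of `L²` spaces. -/
noncomputable def weakDerivsEquiv (par : SystemParams) : par.EnergySpace ≃L[ℂ]
    IntervalL2 (-par.ℓ₁) 0 × IntervalL2 0 par.ℓ₂ × IntervalL2 0 par.ℓ₂ × IntervalL2 0 par.ℓ₂ ×
      IntervalL2 0 par.ℓ₂ × Lp (IntervalL2 0 par.ℓ₂) 2 (volume : Measure ℝ) :=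
  (LinearEquiv.ofBijective (weakDerivs par) weakDerivs_bijective).toContinuousLinearEquivOfBounds
    (exists_norm_weakDerivs_le par).choose (exists_norm_le_weakDerivs par).choose
    (exists_norm_weakDerivs_le par).choose_spec fun y => by
      obtain ⟨U, rfl⟩ := (LinearEquiv.ofBijective (weakDerivs par) weakDerivs_bijective).surjective y
      rw [LinearEquiv.symm_apply_apply]
      exact (exists_norm_le_weakDerivs par).choose_spec U

instance : CompleteSpace par.EnergySpace :=
  (completeSpace_congr (e := (weakDerivsEquiv par).toEquiv)
    (weakDerivsEquiv par).isUniformEmbedding).2 inferInstance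

theorem continuous_weakDerivs : Continuous fun U : par.EnergySpace =>
    (U.z, weakDeriv U.v, U.V, weakDeriv U.p, U.P, U.φ) := (weakDerivsEquiv par).continuous

theorem continuous_z : Continuous fun U : par.EnergySpace => U.z := continuous_weakDerivs.fst

theorem continuous_weakDeriv_v : Continuous fun U : par.EnergySpace => weakDeriv U.v :=
  continuous_weakDerivs.snd.fst

theorem continuous_V : Continuous fun U : par.EnergySpace => U.V := continuous_weakDerivs.snd.snd.fst

theorem continuous_weakDeriv_p : Continuous fun U : par.EnergySpace => weakDeriv U.p :=
  continuous_weakDerivs.snd.snd.snd.fst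

theorem continuous_P : Continuous fun U : par.EnergySpace => U.P :=
  continuous_weakDerivs.snd.snd.snd.snd.fst

end SystemParams.EnergySpace

/-! ### Dissipativity of the evolution operator -/

namespace SystemParams.EnergySpace

variable {par : SystemParams}

/-- The strain energy in terms of the stress `σ = χ v_x - γ β p_x` and the voltage
`τ = β p_x - γ β v_x`. -/
theorem strain_inner_eq (w q v p : IntervalL2 0 par.ℓ₂) :
    par.χ₁ * inner ℂ w v + par.β * inner ℂ ((par.γ : ℂ) • w - q) ((par.γ : ℂ) • v - p) =
      inner ℂ w ((par.χ : ℂ) • v - ((par.γ * par.β : ℝ) : ℂ) • p)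
        + inner ℂ q ((par.β : ℂ) • p - ((par.γ * par.β : ℝ) : ℂ) • v) := by
  simp only [inner_sub_left, inner_sub_right, inner_smul_left, inner_smul_right,
    Complex.conj_ofReal, SystemParams.χ₁]
  push_cast
  ring

/-- The damping exerted on the memory variable is at most the energy that it takes from `V`. -/
theorem re_inner_memory_le {U : par.EnergySpace} (hU : U.InDomain) :
    (inner ℂ (evolutionFun U hU).φ U.φ).re ≤
      (inner ℂ U.V (∫ ξ : ℝ, par.weight ξ • U.φ ξ)).re := by
  have hi := hU.integrable
  have h1 : inner ℂ U.V (∫ ξ : ℝ, par.weight ξ • U.φ ξ) =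
      ∫ ξ : ℝ, inner ℂ U.V (par.weight ξ • U.φ ξ) := (integral_inner hi U.V).symm
  have hi1 : Integrable fun ξ => inner ℂ U.V (par.weight ξ • U.φ ξ) := hi.const_inner U.V
  have hi2 : Integrable fun ξ => inner ℂ ((evolutionFun U hU).φ ξ) (U.φ ξ) :=
    L2.integrable_inner _ _
  rw [h1, L2.inner_def]
  have r1 : (∫ ξ : ℝ, inner ℂ U.V (par.weight ξ • U.φ ξ)).re =
      ∫ ξ : ℝ, (inner ℂ U.V (par.weight ξ • U.φ ξ)).re := (integral_re hi1).symm
  have r2 : (∫ ξ : ℝ, inner ℂ ((evolutionFun U hU).φ ξ) (U.φ ξ)).re =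
      ∫ ξ : ℝ, (inner ℂ ((evolutionFun U hU).φ ξ) (U.φ ξ)).re := (integral_re hi2).symm
  rw [r1, r2]
  refine integral_mono_ae hi2.re hi1.re ?_
  filter_upwards [hU.memLp_memory.coeFn_toLp] with ξ hξ
  rw [evolutionFun_φ, hξ]
  have hn : 0 ≤ (|ξ| ^ 2 + par.η) * ‖U.φ ξ‖ ^ 2 := by
    have := par.η_nonneg
    positivity
  simp only [← IntervalL2.ofReal_smul, inner_add_left, inner_neg_left, inner_smul_left,
    inner_smul_right, Complex.conj_ofReal, inner_self_eq_norm_sq_to_K, Complex.coe_algebraMap,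
    Complex.add_re, Complex.neg_re]
  rw [← Complex.ofReal_pow, ← Complex.ofReal_mul, Complex.ofReal_re]
  linarith

theorem re_inner_evolutionFun_le {U : par.EnergySpace} (hU : U.InDomain) :
    (inner ℂ (evolutionFun U hU) U).re ≤ 0 := by
  set σ := (par.χ : ℂ) • weakDeriv U.v - ((par.γ * par.β : ℝ) : ℂ) • weakDeriv U.p with hσ
  set τ := (par.β : ℂ) • weakDeriv U.p - ((par.γ * par.β : ℝ) : ℂ) • weakDeriv U.v with hτ
  set σ' := (par.χ : ℂ) • weakDeriv (weakDeriv U.v)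
    - ((par.γ * par.β : ℝ) : ℂ) • weakDeriv (weakDeriv U.p) with hσ'
  set τ' := (par.β : ℂ) • weakDeriv (weakDeriv U.p)
    - ((par.γ * par.β : ℝ) : ℂ) • weakDeriv (weakDeriv U.v) with hτ'
  set I := ∫ ξ : ℝ, par.weight ξ • U.φ ξ with hI
  have hv := hasWeakDeriv_weakDeriv hU.v_mem_H2.2
  have hp := hasWeakDeriv_weakDeriv hU.p_mem_H2.2
  have hσw : HasWeakDeriv σ σ' := (hv.smul _).sub (hp.smul _)
  have hτw : HasWeakDeriv τ τ' := (hp.smul _).sub (hv.smul _)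
  have h0 : (0 : ℝ) ∈ Icc 0 par.ℓ₂ := left_mem_Icc.2 par.ℓ₂_pos.le
  have hσ0 : pointValue σ 0 = par.κ * pointValue (weakDeriv U.z) 0 := by
    rw [hσ, pointValue_sub par.ℓ₂_pos (Submodule.smul_mem _ _ hv.mem)
      (Submodule.smul_mem _ _ hp.mem) h0, pointValue_smul par.ℓ₂_pos _ hv.mem h0,
      pointValue_smul par.ℓ₂_pos _ hp.mem h0, ← hU.stress]
    push_cast
    ring
  have hτ0 : pointValue τ 0 = 0 := by
    rw [hτ, pointValue_sub par.ℓ₂_pos (Submodule.smul_mem _ _ hp.mem)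
      (Submodule.smul_mem _ _ hv.mem) h0, pointValue_smul par.ℓ₂_pos _ hv.mem h0,
      pointValue_smul par.ℓ₂_pos _ hp.mem h0, hU.voltage]
    push_cast
    ring
  have ibz := (hasWeakDeriv_weakDeriv hU.z_mem_H2.2).inner_add_inner par.neg_ℓ₁_lt_zero
    (hasWeakDeriv_weakDeriv hU.z_mem_H2.1)
  have ibV := hσw.inner_add_inner par.ℓ₂_pos (hasWeakDeriv_weakDeriv hU.V_mem_H1R.1)
  have ibP := hτw.inner_add_inner par.ℓ₂_pos (hasWeakDeriv_weakDeriv hU.P_mem_H1R.1)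
  rw [hU.z_mem_H1L.2, hU.transmission, mul_zero, sub_zero] at ibz
  rw [hσ0, hU.V_mem_H1R.2, mul_zero, zero_sub, map_mul, Complex.conj_ofReal] at ibV
  rw [hτ0, hU.P_mem_H1R.2, mul_zero, zero_sub, map_zero, zero_mul, neg_zero] at ibP
  have hφ := mul_le_mul_of_nonneg_left (re_inner_memory_le hU) par.fracConst_pos.le
  rw [← hI] at hφ
  -- The boundary terms `κ z_x(0) z(0)` and `-σ(0) V(0)` of `ibz` and `ibV` cancel.
  have e : inner ℂ (evolutionFun U hU) U =
      - (par.κ * inner ℂ (weakDeriv U.z) (weakDeriv U.z))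
      + (inner ℂ (weakDeriv U.V) σ - inner ℂ σ (weakDeriv U.V))
      + (inner ℂ (weakDeriv U.P) τ - inner ℂ τ (weakDeriv U.P))
      + par.fracConst * (inner ℂ (evolutionFun U hU).φ U.φ - inner ℂ I U.V) := by
    have hs := strain_inner_eq (weakDeriv U.V) (weakDeriv U.P) (weakDeriv U.v) (weakDeriv U.p)
    have hV : (par.ρ : ℂ) * inner ℂ (evolutionFun U hU).V U.V =
        inner ℂ σ' U.V - par.fracConst * inner ℂ I U.V := by
      rw [evolutionFun_V, hσ', ← hI]
      have := Complex.ofReal_ne_zero.2 par.ρ_pos.ne'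
      simp only [← IntervalL2.ofReal_smul, inner_smul_left, inner_sub_left, Complex.conj_ofReal]
      push_cast
      field_simp
    have hP : (par.mag : ℂ) * inner ℂ (evolutionFun U hU).P U.P = inner ℂ τ' U.P := by
      rw [evolutionFun_P, hτ']
      have := Complex.ofReal_ne_zero.2 par.mag_pos.ne'
      simp only [← IntervalL2.ofReal_smul, inner_smul_left, inner_sub_left, Complex.conj_ofReal]
      push_cast
      field_simp
    have hz : inner ℂ (evolutionFun U hU).z U.z =
        par.κ * inner ℂ (weakDeriv (weakDeriv U.z)) U.z := by
      rw [evolutionFun_z, ← IntervalL2.ofReal_smul, inner_smul_left, Complex.conj_ofReal]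
    rw [inner_def, energyInner, hV, hP, hz, evolutionFun_v, evolutionFun_p]
    linear_combination hs + par.κ * ibz + ibV + ibP
  have re_comm {x y : IntervalL2 0 par.ℓ₂} : (inner ℂ x y).re = (inner ℂ y x).re := by
    rw [← inner_conj_symm, Complex.conj_re]
  rw [e]
  simp only [Complex.add_re, Complex.sub_re, Complex.neg_re, Complex.re_ofReal_mul,
    inner_self_eq_norm_sq_to_K, Complex.coe_algebraMap]
  rw [re_comm (x := σ), re_comm (x := τ), re_comm (x := I), ← Complex.ofReal_pow,
    Complex.ofReal_re]
  have hk := mul_nonneg par.κ_pos.le (sq_nonneg ‖weakDeriv U.z‖)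
  linarith

end SystemParams.EnergySpace

theorem SystemParams.isDissipative_evolutionOperator (par : SystemParams) :
    par.evolutionOperator.IsDissipative := fun U => EnergySpace.re_inner_evolutionFun_le U.2

/-! ### The stationary problem -/

section Sobolev

variable {a b : ℝ}

/-- The natural boundary condition: an identity tested with functions that are free at `a` forces the
value at `a` to vanish. -/
theorem pointValue_left_eq_zero_of_forall (hab : a < b) {y y' : IntervalL2 a b}
    (h : HasWeakDeriv y y')
    (h0 : ∀ u ∈ SobolevH1R hab, inner ℂ (weakDeriv u) y + inner ℂ u y' = 0) :
    pointValue y a = 0 := by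
  obtain ⟨e, he, ha, hb⟩ := exists_pointValue_eq hab 1 0
  have := (hasWeakDeriv_weakDeriv he).inner_add_inner hab h
  rw [h0 e ⟨he, hb⟩, ha, hb] at this
  simpa using this

/-- Weak differentiability can be tested with `H¹` functions: a test function is an element of
`H¹(a, b)` that vanishes at both end points. -/
theorem hasWeakDeriv_of_forall (hab : a < b) {y y' : IntervalL2 a b}
    (h : ∀ u ∈ SobolevH1L hab, u ∈ SobolevH1R hab →
      inner ℂ (weakDeriv u) y + inner ℂ u y' = 0) : HasWeakDeriv y y' := by
  intro g hg
  have hg1 : Continuous g := hg.contDiff.continuous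
  obtain ⟨C, hC⟩ := hg.hasCompactSupport.exists_bound_of_continuous hg1
  obtain ⟨D, hD⟩ := hg.hasCompactSupport.deriv.exists_bound_of_continuous hg.continuous_deriv
  have hm : MemLp (fun x => (g x : ℂ)) 2 (volume.restrict (Ioo a b)) :=
    MemLp.of_bound (by fun_prop) C (Eventually.of_forall fun x => by simpa using hC x)
  have hm' : MemLp (fun x => ((deriv g x : ℝ) : ℂ)) 2 (volume.restrict (Ioo a b)) :=
    MemLp.of_bound (by have := hg.continuous_deriv; fun_prop) D
      (Eventually.of_forall fun x => by simpa using hD x)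
  have e {f : ℝ → ℝ} (hf : MemLp (fun x => (f x : ℂ)) 2 (volume.restrict (Ioo a b)))
      (u : IntervalL2 a b) : ∫ x in Ioo a b, f x • u x = inner ℂ (hf.toLp _) u := by
    rw [L2.inner_def]
    refine integral_congr_ae ?_
    filter_upwards [hf.coeFn_toLp] with x hx
    rw [hx, RCLike.inner_apply, Complex.conj_ofReal, Complex.real_smul, mul_comm]
  have ga : g a = 0 := by
    by_contra h
    exact lt_irrefl a (hg.tsupport_subset (subset_tsupport g h)).1
  have hrep : IsContinuousRep (hm.toLp _) fun x => (g x : ℂ) :=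
    ⟨by fun_prop, hm.coeFn_toLp⟩
  -- The classical derivative of `g` is its weak derivative: both have the same primitive.
  have hw : HasWeakDeriv (hm.toLp _) (hm'.toLp _) := by
    obtain ⟨u, hu, hc⟩ := exists_hasWeakDeriv hab (hm'.toLp _) 0
    have : hm.toLp _ = u := by
      refine Lp.ext ?_
      filter_upwards [hm.coeFn_toLp, hc.2, ae_restrict_mem measurableSet_Ioo] with x h1 h2 hx
      have h3 : ∫ t in a..x, (hm'.toLp (fun x => ((deriv g x : ℝ) : ℂ))) t =
          ∫ t in a..x, ((deriv g t : ℝ) : ℂ) := by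
        rw [intervalIntegral.integral_of_le hx.1.le, intervalIntegral.integral_of_le hx.1.le]
        have hss : Ioc a x ⊆ Ioo a b := fun t ht => ⟨ht.1, ht.2.trans_lt hx.2⟩
        exact integral_congr_ae (ae_restrict_of_ae_restrict_of_subset hss hm'.coeFn_toLp)
      rw [h1, h2, h3, intervalIntegral.integral_eq_sub_of_hasDerivAt
        (fun t _ => (hg.hasDerivAt t).ofReal_comp)
        ((Complex.continuous_ofReal.comp hg.continuous_deriv).intervalIntegrable _ _), ga]
      simp
    rwa [this]
  have hl : hm.toLp _ ∈ SobolevH1L hab := ⟨hw.mem, by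
    rw [hrep.pointValue_eq hab (left_mem_Icc.2 hab.le), ga, Complex.ofReal_zero]⟩
  have hr : hm.toLp _ ∈ SobolevH1R hab := ⟨hw.mem, by
    rw [hrep.pointValue_eq hab (right_mem_Icc.2 hab.le), hg.eq_zero_right, Complex.ofReal_zero]⟩
  have := h _ hl hr
  rw [hw.weakDeriv_eq] at this
  rw [e hm, e hm']
  exact eq_neg_of_add_eq_zero_left this

end Sobolev

namespace SystemParams

open EnergySpace

variable (par : SystemParams)

/-- The space of the pairs `((z, V, V, P, P, φ), √κ z_x)`, where `z, V, P` lie in `H¹`, vanish at the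
outer ends of the rod and the beam, and satisfy `z(0) = V(0)`. Membership is expressed by weak
derivatives; `v = V` and `p = P` follow, and `φ` is unrestricted, which is harmless since `φ = 0` in all
test elements. -/
noncomputable def formSpace : Submodule ℂ (par.EnergySpace × IntervalL2 (-par.ℓ₁) 0) where
  carrier := {y | HasWeakDeriv ((√par.κ : ℂ) • y.1.z) y.2 ∧ HasWeakDeriv y.1.V (weakDeriv y.1.v) ∧
    HasWeakDeriv y.1.P (weakDeriv y.1.p) ∧ pointValue ((√par.κ : ℂ) • y.1.z) (-par.ℓ₁) = 0 ∧
    pointValue y.1.V par.ℓ₂ = 0 ∧ pointValue y.1.P par.ℓ₂ = 0 ∧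
    pointValue ((√par.κ : ℂ) • y.1.z) 0 = √par.κ * pointValue y.1.V 0}
  add_mem' := by
    rintro ⟨U, w⟩ ⟨U', w'⟩ ⟨h1, h2, h3, h4, h5, h6, h7⟩ ⟨k1, k2, k3, k4, k5, k6, k7⟩
    have l1 : (-par.ℓ₁) ∈ Icc (-par.ℓ₁) 0 := left_mem_Icc.2 par.neg_ℓ₁_lt_zero.le
    have l2 : (0 : ℝ) ∈ Icc (-par.ℓ₁) 0 := right_mem_Icc.2 par.neg_ℓ₁_lt_zero.le
    have l3 : (0 : ℝ) ∈ Icc 0 par.ℓ₂ := left_mem_Icc.2 par.ℓ₂_pos.le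
    have l4 : par.ℓ₂ ∈ Icc 0 par.ℓ₂ := right_mem_Icc.2 par.ℓ₂_pos.le
    simp only [mem_ofPred_eq, Prod.fst_add, Prod.snd_add, add_z, add_V, add_P, add_v, add_p,
      smul_add, weakDeriv_add U.v_mem.1 U'.v_mem.1, weakDeriv_add U.p_mem.1 U'.p_mem.1,
      pointValue_add par.neg_ℓ₁_lt_zero h1.mem k1.mem l1,
      pointValue_add par.neg_ℓ₁_lt_zero h1.mem k1.mem l2,
      pointValue_add par.ℓ₂_pos h2.mem k2.mem l3, pointValue_add par.ℓ₂_pos h2.mem k2.mem l4,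
      pointValue_add par.ℓ₂_pos h3.mem k3.mem l4]
    refine ⟨h1.add k1, h2.add k2, h3.add k3, ?_, ?_, ?_, ?_⟩
    · rw [h4, k4, add_zero]
    · rw [h5, k5, add_zero]
    · rw [h6, k6, add_zero]
    · rw [h7, k7, mul_add]
  zero_mem' := by
    have l1 : (-par.ℓ₁) ∈ Icc (-par.ℓ₁) 0 := left_mem_Icc.2 par.neg_ℓ₁_lt_zero.le
    have l2 : (0 : ℝ) ∈ Icc (-par.ℓ₁) 0 := right_mem_Icc.2 par.neg_ℓ₁_lt_zero.le
    have l3 : (0 : ℝ) ∈ Icc 0 par.ℓ₂ := left_mem_Icc.2 par.ℓ₂_pos.le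
    have l4 : par.ℓ₂ ∈ Icc 0 par.ℓ₂ := right_mem_Icc.2 par.ℓ₂_pos.le
    simp only [mem_ofPred_eq, Prod.fst_zero, Prod.snd_zero, zero_z, zero_V, zero_P, zero_v, zero_p,
      smul_zero, weakDeriv_zero, pointValue_zero par.neg_ℓ₁_lt_zero l1,
      pointValue_zero par.neg_ℓ₁_lt_zero l2, pointValue_zero par.ℓ₂_pos l3,
      pointValue_zero par.ℓ₂_pos l4, mul_zero, and_self, and_true]
    exact ⟨.zero _ _, .zero _ _⟩
  smul_mem' := by
    rintro c ⟨U, w⟩ ⟨h1, h2, h3, h4, h5, h6, h7⟩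
    have l1 : (-par.ℓ₁) ∈ Icc (-par.ℓ₁) 0 := left_mem_Icc.2 par.neg_ℓ₁_lt_zero.le
    have l2 : (0 : ℝ) ∈ Icc (-par.ℓ₁) 0 := right_mem_Icc.2 par.neg_ℓ₁_lt_zero.le
    have l3 : (0 : ℝ) ∈ Icc 0 par.ℓ₂ := left_mem_Icc.2 par.ℓ₂_pos.le
    have l4 : par.ℓ₂ ∈ Icc 0 par.ℓ₂ := right_mem_Icc.2 par.ℓ₂_pos.le
    simp only [mem_ofPred_eq, Prod.smul_fst, Prod.smul_snd, smul_z, smul_V, smul_P, smul_v, smul_p,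
      smul_comm _ c, weakDeriv_smul c U.v_mem.1, weakDeriv_smul c U.p_mem.1,
      pointValue_smul par.neg_ℓ₁_lt_zero c h1.mem l1,
      pointValue_smul par.neg_ℓ₁_lt_zero c h1.mem l2,
      pointValue_smul par.ℓ₂_pos c h2.mem l3, pointValue_smul par.ℓ₂_pos c h2.mem l4,
      pointValue_smul par.ℓ₂_pos c h3.mem l4]
    refine ⟨h1.smul c, h2.smul c, h3.smul c, ?_, ?_, ?_, ?_⟩
    · rw [h4, mul_zero]
    · rw [h5, mul_zero]
    · rw [h6, mul_zero]
    · rw [h7]; ring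

theorem isClosed_formSpace :
    IsClosed (par.formSpace : Set (par.EnergySpace × IntervalL2 (-par.ℓ₁) 0)) := by
  obtain ⟨e1, e1', h1⟩ := exists_pointValue_left_eq_inner par.neg_ℓ₁_lt_zero
  obtain ⟨e2, e2', h2⟩ := exists_pointValue_right_eq_inner par.neg_ℓ₁_lt_zero
  obtain ⟨e3, e3', h3⟩ := exists_pointValue_left_eq_inner par.ℓ₂_pos
  obtain ⟨e4, e4', h4⟩ := exists_pointValue_right_eq_inner par.ℓ₂_pos
  have e : (par.formSpace : Set (par.EnergySpace × IntervalL2 (-par.ℓ₁) 0)) =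
      {y | HasWeakDeriv ((√par.κ : ℂ) • y.1.z) y.2 ∧ HasWeakDeriv y.1.V (weakDeriv y.1.v) ∧
        HasWeakDeriv y.1.P (weakDeriv y.1.p) ∧
        inner ℂ e1' ((√par.κ : ℂ) • y.1.z) + inner ℂ e1 y.2 = 0 ∧
        inner ℂ e4' y.1.V + inner ℂ e4 (weakDeriv y.1.v) = 0 ∧
        inner ℂ e4' y.1.P + inner ℂ e4 (weakDeriv y.1.p) = 0 ∧
        inner ℂ e2' ((√par.κ : ℂ) • y.1.z) + inner ℂ e2 y.2 =
          √par.κ * (inner ℂ e3' y.1.V + inner ℂ e3 (weakDeriv y.1.v))} := by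
    ext y
    refine and_congr_right fun k1 => and_congr_right fun k2 => and_congr_right fun k3 => ?_
    rw [h1 _ _ k1, h4 _ _ k2, h4 _ _ k3, h2 _ _ k1, h3 _ _ k2]
  have cz : Continuous fun y : par.EnergySpace × IntervalL2 (-par.ℓ₁) 0 => (√par.κ : ℂ) • y.1.z :=
    (continuous_z.comp continuous_fst).const_smul (√par.κ : ℂ)
  have cV : Continuous fun y : par.EnergySpace × IntervalL2 (-par.ℓ₁) 0 => y.1.V :=
    continuous_V.comp continuous_fst
  have cP : Continuous fun y : par.EnergySpace × IntervalL2 (-par.ℓ₁) 0 => y.1.P :=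
    continuous_P.comp continuous_fst
  have cv : Continuous fun y : par.EnergySpace × IntervalL2 (-par.ℓ₁) 0 => weakDeriv y.1.v :=
    continuous_weakDeriv_v.comp continuous_fst
  have cp : Continuous fun y : par.EnergySpace × IntervalL2 (-par.ℓ₁) 0 => weakDeriv y.1.p :=
    continuous_weakDeriv_p.comp continuous_fst
  have cw : Continuous fun y : par.EnergySpace × IntervalL2 (-par.ℓ₁) 0 => y.2 := continuous_snd
  rw [e]
  refine (isClosed_hasWeakDeriv.preimage (cz.prodMk cw)).inter <|
    (isClosed_hasWeakDeriv.preimage (cV.prodMk cv)).inter <|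
    (isClosed_hasWeakDeriv.preimage (cP.prodMk cp)).inter <| IsClosed.inter ?_ <|
    IsClosed.inter ?_ <| IsClosed.inter ?_ ?_
  · exact isClosed_eq ((continuous_const.inner cz).add (continuous_const.inner cw)) continuous_const
  · exact isClosed_eq ((continuous_const.inner cV).add (continuous_const.inner cv)) continuous_const
  · exact isClosed_eq ((continuous_const.inner cP).add (continuous_const.inner cp)) continuous_const
  · exact isClosed_eq ((continuous_const.inner cz).add (continuous_const.inner cw))
      (continuous_const.mul ((continuous_const.inner cV).add (continuous_const.inner cv)))

variable {par} in
theorem mem_formSpace {ζ : IntervalL2 (-par.ℓ₁) 0} (hζ : ζ ∈ SobolevH1L par.neg_ℓ₁_lt_zero)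
    (W Q : SobolevH1R par.ℓ₂_pos)
    (h : pointValue ζ 0 = pointValue (W : IntervalL2 0 par.ℓ₂) 0) :
    (EnergySpace.mk ζ W W Q Q 0, (√par.κ : ℂ) • weakDeriv ζ) ∈ par.formSpace := by
  refine ⟨(hasWeakDeriv_weakDeriv hζ.1).smul _, hasWeakDeriv_weakDeriv W.2.1,
    hasWeakDeriv_weakDeriv Q.2.1, ?_, W.2.2, Q.2.2, ?_⟩
  · change pointValue ((√par.κ : ℂ) • ζ) (-par.ℓ₁) = 0
    rw [pointValue_smul par.neg_ℓ₁_lt_zero _ hζ.1 (left_mem_Icc.2 par.neg_ℓ₁_lt_zero.le), hζ.2,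
      mul_zero]
  · change pointValue ((√par.κ : ℂ) • ζ) 0 = √par.κ * pointValue (W : IntervalL2 0 par.ℓ₂) 0
    rw [pointValue_smul par.neg_ℓ₁_lt_zero _ hζ.1 (right_mem_Icc.2 par.neg_ℓ₁_lt_zero.le), h]

/-- The weak formulation of the stationary problem. Its solution is the orthogonal projection of the
data `((f₁, -f₂, f₃, -f₄, f₅, 0), 0)` onto `formSpace`. -/
theorem exists_weak_solution (f₁ : IntervalL2 (-par.ℓ₁) 0) (f₂ : SobolevH1R par.ℓ₂_pos)
    (f₃ : IntervalL2 0 par.ℓ₂) (f₄ : SobolevH1R par.ℓ₂_pos) (f₅ : IntervalL2 0 par.ℓ₂) :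
    ∃ z ∈ SobolevH1L par.neg_ℓ₁_lt_zero, ∃ V ∈ SobolevH1R par.ℓ₂_pos,
    ∃ P ∈ SobolevH1R par.ℓ₂_pos, pointValue z 0 = pointValue V 0 ∧
    ∀ ζ ∈ SobolevH1L par.neg_ℓ₁_lt_zero, ∀ W ∈ SobolevH1R par.ℓ₂_pos,
    ∀ Q ∈ SobolevH1R par.ℓ₂_pos, pointValue ζ 0 = pointValue W 0 →
      inner ℂ (weakDeriv ζ) ((par.κ : ℂ) • weakDeriv z) + inner ℂ ζ (z - f₁)
      + (inner ℂ (weakDeriv W) ((par.χ : ℂ) • (weakDeriv V + weakDeriv f₂)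
          - ((par.γ * par.β : ℝ) : ℂ) • (weakDeriv P + weakDeriv f₄))
        + inner ℂ W ((par.ρ : ℂ) • (V - f₃)))
      + (inner ℂ (weakDeriv Q) ((par.β : ℂ) • (weakDeriv P + weakDeriv f₄)
          - ((par.γ * par.β : ℝ) : ℂ) • (weakDeriv V + weakDeriv f₂))
        + inner ℂ Q ((par.mag : ℂ) • (P - f₅))) = 0 := by
  let M : Submodule ℂ (WithLp 2 (par.EnergySpace × IntervalL2 (-par.ℓ₁) 0)) :=
    par.formSpace.comap (WithLp.linearEquiv 2 ℂ _).toLinearMap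
  have hM : IsClosed (M : Set (WithLp 2 (par.EnergySpace × IntervalL2 (-par.ℓ₁) 0))) :=
    par.isClosed_formSpace.preimage (WithLp.prod_continuous_ofLp 2 _ _)
  have : CompleteSpace M := hM.completeSpace_coe
  obtain ⟨y, hy, n, hn, hyn⟩ := M.exists_add_mem_mem_orthogonal
    (WithLp.toLp 2 (EnergySpace.mk f₁ (-f₂) f₃ (-f₄) f₅ 0, 0))
  have hy' : WithLp.ofLp y ∈ par.formSpace := hy
  obtain ⟨⟨U, w⟩⟩ := y
  obtain ⟨h1, h2, h3, h4, h5, h6, h7⟩ := hy'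
  have hs : (√par.κ : ℂ) ≠ 0 := Complex.ofReal_ne_zero.2 (Real.sqrt_pos.2 par.κ_pos).ne'
  have hz : U.z ∈ SobolevH1 (-par.ℓ₁) 0 := (Submodule.smul_mem_iff _ hs).1 h1.mem
  have hw : w = (√par.κ : ℂ) • weakDeriv U.z := by
    rw [← weakDeriv_smul _ hz, h1.weakDeriv_eq]
  change pointValue ((√par.κ : ℂ) • U.z) (-par.ℓ₁) = 0 at h4
  change pointValue ((√par.κ : ℂ) • U.z) 0 = √par.κ * pointValue U.V 0 at h7
  rw [pointValue_smul par.neg_ℓ₁_lt_zero _ hz (left_mem_Icc.2 par.neg_ℓ₁_lt_zero.le)] at h4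
  rw [pointValue_smul par.neg_ℓ₁_lt_zero _ hz (right_mem_Icc.2 par.neg_ℓ₁_lt_zero.le)] at h7
  refine ⟨U.z, ⟨hz, (mul_eq_zero.1 h4).resolve_left hs⟩, U.V, ⟨h2.mem, h5⟩, U.P, ⟨h3.mem, h6⟩,
    mul_left_cancel₀ hs h7, fun ζ hζ W hW Q hQ hζW => ?_⟩
  have hort := hn (WithLp.toLp 2 (EnergySpace.mk ζ ⟨W, hW⟩ W ⟨Q, hQ⟩ Q 0, (√par.κ : ℂ) • weakDeriv ζ))
    (mem_formSpace hζ ⟨W, hW⟩ ⟨Q, hQ⟩ hζW)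
  have hn' : n = WithLp.toLp 2 (EnergySpace.mk f₁ (-f₂) f₃ (-f₄) f₅ 0, 0) - WithLp.toLp 2 (U, w) := by
    rw [hyn, add_sub_cancel_left]
  have e2 : weakDeriv (-(f₂ : IntervalL2 0 par.ℓ₂)) = -weakDeriv (f₂ : IntervalL2 0 par.ℓ₂) := by
    rw [← neg_one_smul ℂ, weakDeriv_smul _ f₂.2.1, neg_one_smul]
  have e4 : weakDeriv (-(f₄ : IntervalL2 0 par.ℓ₂)) = -weakDeriv (f₄ : IntervalL2 0 par.ℓ₂) := by
    rw [← neg_one_smul ℂ, weakDeriv_smul _ f₄.2.1, neg_one_smul]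
  have k1 : energyInner (EnergySpace.mk ζ ⟨W, hW⟩ W ⟨Q, hQ⟩ Q 0)
      (EnergySpace.mk f₁ (-f₂) f₃ (-f₄) f₅ 0) = inner ℂ ζ f₁
      + par.χ₁ * inner ℂ (weakDeriv W) (weakDeriv (-(f₂ : IntervalL2 0 par.ℓ₂)))
      + par.ρ * inner ℂ W f₃ + par.mag * inner ℂ Q f₅
      + par.β * inner ℂ ((par.γ : ℂ) • weakDeriv W - weakDeriv Q)
        ((par.γ : ℂ) • weakDeriv (-(f₂ : IntervalL2 0 par.ℓ₂))
          - weakDeriv (-(f₄ : IntervalL2 0 par.ℓ₂)))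
      + par.fracConst * inner ℂ (0 : Lp (IntervalL2 0 par.ℓ₂) 2 (volume : Measure ℝ)) 0 := rfl
  have k2 : energyInner (EnergySpace.mk ζ ⟨W, hW⟩ W ⟨Q, hQ⟩ Q 0) U = inner ℂ ζ U.z
      + par.χ₁ * inner ℂ (weakDeriv W) (weakDeriv U.v)
      + par.ρ * inner ℂ W U.V + par.mag * inner ℂ Q U.P
      + par.β * inner ℂ ((par.γ : ℂ) • weakDeriv W - weakDeriv Q)
        ((par.γ : ℂ) • weakDeriv U.v - weakDeriv U.p)
      + par.fracConst * inner ℂ (0 : Lp (IntervalL2 0 par.ℓ₂) 2 (volume : Measure ℝ)) U.φ := rfl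
  rw [hn', inner_sub_right, WithLp.prod_inner_apply, WithLp.prod_inner_apply, inner_def, inner_def,
    k1, k2, e2, e4, hw] at hort
  have hsq : (√par.κ : ℂ) * √par.κ = par.κ := by
    rw [← Complex.ofReal_mul, Real.mul_self_sqrt par.κ_pos.le]
  have hs1 := strain_inner_eq (par := par) (weakDeriv W) (weakDeriv Q) (weakDeriv U.V + weakDeriv f₂)
    (weakDeriv U.P + weakDeriv f₄)
  rw [h2.weakDeriv_eq, h3.weakDeriv_eq] at hs1 ⊢
  simp only [inner_sub_left, inner_sub_right, inner_add_right, inner_smul_left, inner_smul_right,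
    Complex.conj_ofReal, inner_neg_right, inner_zero_left, inner_zero_right] at hort hs1 ⊢
  linear_combination -hort - hs1 - inner ℂ (weakDeriv ζ) (weakDeriv U.z) * hsq

end SystemParams

namespace SystemParams

variable (par : SystemParams)

/-- The strong formulation of the stationary problem: testing the weak formulation inside the
intervals yields the differential equations, and testing at the interface yields the transmission
conditions. -/
theorem exists_strong_solution (f₁ : IntervalL2 (-par.ℓ₁) 0) (f₂ : SobolevH1R par.ℓ₂_pos)
    (f₃ : IntervalL2 0 par.ℓ₂) (f₄ : SobolevH1R par.ℓ₂_pos) (f₅ : IntervalL2 0 par.ℓ₂) :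
    ∃ z ∈ SobolevH1L par.neg_ℓ₁_lt_zero, ∃ V ∈ SobolevH1R par.ℓ₂_pos,
    ∃ P ∈ SobolevH1R par.ℓ₂_pos, ∃ σ τ : IntervalL2 0 par.ℓ₂,
      σ = (par.χ : ℂ) • weakDeriv (V + f₂.1) - ((par.γ * par.β : ℝ) : ℂ) • weakDeriv (P + f₄.1) ∧
      τ = (par.β : ℂ) • weakDeriv (P + f₄.1) - ((par.γ * par.β : ℝ) : ℂ) • weakDeriv (V + f₂.1) ∧
      HasWeakDeriv ((par.κ : ℂ) • weakDeriv z) (z - f₁) ∧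
      HasWeakDeriv σ ((par.ρ : ℂ) • (V - f₃)) ∧ HasWeakDeriv τ ((par.mag : ℂ) • (P - f₅)) ∧
      pointValue z 0 = pointValue V 0 ∧
      pointValue σ 0 = pointValue ((par.κ : ℂ) • weakDeriv z) 0 ∧ pointValue τ 0 = 0 := by
  obtain ⟨z, hz, V, hV, P, hP, hzV, h⟩ := par.exists_weak_solution f₁ f₂ f₃ f₄ f₅
  simp only [← weakDeriv_add hV.1 f₂.2.1, ← weakDeriv_add hP.1 f₄.2.1] at h
  refine ⟨z, hz, V, hV, P, hP, _, _, rfl, rfl, ?_⟩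
  set σ := (par.χ : ℂ) • weakDeriv (V + f₂.1) - ((par.γ * par.β : ℝ) : ℂ) • weakDeriv (P + f₄.1)
  set τ := (par.β : ℂ) • weakDeriv (P + f₄.1) - ((par.γ * par.β : ℝ) : ℂ) • weakDeriv (V + f₂.1)
  have l1 : (0 : ℝ) ∈ Icc (-par.ℓ₁) 0 := right_mem_Icc.2 par.neg_ℓ₁_lt_zero.le
  have l2 : (0 : ℝ) ∈ Icc 0 par.ℓ₂ := left_mem_Icc.2 par.ℓ₂_pos.le
  have hzw : HasWeakDeriv ((par.κ : ℂ) • weakDeriv z) (z - f₁) :=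
    hasWeakDeriv_of_forall par.neg_ℓ₁_lt_zero fun ζ hζ hζ' => by
      have := h ζ hζ 0 (zero_mem _) 0 (zero_mem _) (by rw [hζ'.2, pointValue_zero par.ℓ₂_pos l2])
      simpa only [weakDeriv_zero, inner_zero_left, add_zero] using this
  have hσw : HasWeakDeriv σ ((par.ρ : ℂ) • (V - f₃)) :=
    hasWeakDeriv_of_forall par.ℓ₂_pos fun W hW hW' => by
      have := h 0 (zero_mem _) W hW' 0 (zero_mem _)
        (by rw [hW.2, pointValue_zero par.neg_ℓ₁_lt_zero l1])
      simpa only [weakDeriv_zero, inner_zero_left, add_zero, zero_add] using this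
  have hτ (Q : IntervalL2 0 par.ℓ₂) (hQ : Q ∈ SobolevH1R par.ℓ₂_pos) :
      inner ℂ (weakDeriv Q) τ + inner ℂ Q ((par.mag : ℂ) • (P - f₅)) = 0 := by
    have := h 0 (zero_mem _) 0 (zero_mem _) Q hQ
      (by rw [pointValue_zero par.neg_ℓ₁_lt_zero l1, pointValue_zero par.ℓ₂_pos l2])
    simpa only [weakDeriv_zero, inner_zero_left, add_zero, zero_add] using this
  have hτw : HasWeakDeriv τ ((par.mag : ℂ) • (P - f₅)) :=
    hasWeakDeriv_of_forall par.ℓ₂_pos fun Q _ hQ => hτ Q hQ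
  refine ⟨hzw, hσw, hτw, hzV, ?_, pointValue_left_eq_zero_of_forall par.ℓ₂_pos hτw hτ⟩
  -- Test functions with `ζ(0) = W(0) = 1` leave only the boundary terms at the interface.
  obtain ⟨ζ, hζ, ζ0, ζ1⟩ := exists_pointValue_eq par.neg_ℓ₁_lt_zero 0 1
  obtain ⟨W, hW, W0, W1⟩ := exists_pointValue_eq par.ℓ₂_pos 1 0
  have h1 := h ζ ⟨hζ, ζ0⟩ W ⟨hW, W1⟩ 0 (zero_mem _) (by rw [ζ1, W0])
  rw [(hasWeakDeriv_weakDeriv hζ).inner_add_inner par.neg_ℓ₁_lt_zero hzw,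
    (hasWeakDeriv_weakDeriv hW).inner_add_inner par.ℓ₂_pos hσw, ζ0, ζ1, W0, W1, weakDeriv_zero,
    inner_zero_left, inner_zero_left] at h1
  simp only [map_one, map_zero, zero_mul, one_mul, add_zero, sub_zero, zero_sub] at h1
  exact (sub_eq_zero.1 (by rw [sub_eq_add_neg]; exact h1)).symm

/-! ### The memory variable -/

/-- The factor `1 / (1 + |ξ|² + η)`, by which the memory variable is recovered from `V` and the
data. -/
noncomputable def memoryFactor (ξ : ℝ) : ℝ := (1 + |ξ| ^ 2 + par.η)⁻¹

theorem one_add_sq_add_pos (ξ : ℝ) : 0 < 1 + |ξ| ^ 2 + par.η := by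
  have := par.η_nonneg
  positivity

theorem memoryFactor_pos (ξ : ℝ) : 0 < par.memoryFactor ξ := inv_pos.2 (par.one_add_sq_add_pos ξ)

theorem memoryFactor_le (ξ : ℝ) : par.memoryFactor ξ ≤ (1 + ξ ^ 2)⁻¹ := by
  unfold memoryFactor
  rw [sq_abs]
  exact inv_anti₀ (by positivity) (by linarith [par.η_nonneg])

theorem memoryFactor_le_one (ξ : ℝ) : par.memoryFactor ξ ≤ 1 :=
  (par.memoryFactor_le ξ).trans (inv_le_one_of_one_le₀ (by nlinarith [sq_nonneg ξ]))

theorem abs_mul_memoryFactor_le_one (ξ : ℝ) : |ξ| * par.memoryFactor ξ ≤ 1 := by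
  unfold memoryFactor
  rw [← div_eq_mul_inv, div_le_one (par.one_add_sq_add_pos ξ)]
  nlinarith [par.η_nonneg, sq_nonneg (|ξ| - 1)]

theorem measurable_memoryFactor : Measurable par.memoryFactor := by
  unfold memoryFactor
  fun_prop

variable {E : Type*} [NormedAddCommGroup E] [NormedSpace ℝ E]

theorem memLp_memoryFactor_smul (f : Lp E 2 (volume : Measure ℝ)) :
    MemLp (fun ξ => par.memoryFactor ξ • f ξ) 2 := by
  refine (Lp.memLp f).mono
    (par.measurable_memoryFactor.aestronglyMeasurable.smul (Lp.aestronglyMeasurable f))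
    (Eventually.of_forall fun ξ => ?_)
  rw [norm_smul, Real.norm_of_nonneg (par.memoryFactor_pos ξ).le]
  exact mul_le_of_le_one_left (norm_nonneg _) (par.memoryFactor_le_one ξ)

theorem memLp_abs_smul_memoryFactor_smul (f : Lp E 2 (volume : Measure ℝ)) :
    MemLp (fun ξ => |ξ| • par.memoryFactor ξ • f ξ) 2 := by
  refine (Lp.memLp f).mono (measurable_abs.aestronglyMeasurable.smul
    (par.measurable_memoryFactor.aestronglyMeasurable.smul (Lp.aestronglyMeasurable f)))
    (Eventually.of_forall fun ξ => ?_)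
  rw [smul_smul, norm_smul,
    Real.norm_of_nonneg (mul_nonneg (abs_nonneg ξ) (par.memoryFactor_pos ξ).le)]
  exact mul_le_of_le_one_left (norm_nonneg _) (par.abs_mul_memoryFactor_le_one ξ)

theorem integrable_memoryFactor_mul_weight_sq :
    Integrable fun ξ => par.memoryFactor ξ * par.weight ξ ^ 2 := by
  refine par.integrable_weight_sq_div.mono' (par.measurable_memoryFactor.mul
    (par.measurable_weight.pow_const 2)).aestronglyMeasurable (Eventually.of_forall fun ξ => ?_)
  rw [Real.norm_of_nonneg (mul_nonneg (par.memoryFactor_pos ξ).le (sq_nonneg _)), mul_comm,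
    div_eq_mul_inv]
  exact mul_le_mul_of_nonneg_left (par.memoryFactor_le ξ) (sq_nonneg _)

/-- Multiples of `μ(ξ) / (1 + |ξ|² + η)` by a function `r` with `r² ≤ 1 + |ξ|² + η` are square
integrable. -/
theorem memLp_mul_memoryFactor_smul {r : ℝ → ℝ} (hr : Measurable r)
    (h : ∀ ξ, r ξ ^ 2 * par.memoryFactor ξ ≤ 1) (V : E) :
    MemLp (fun ξ => r ξ • par.memoryFactor ξ • par.weight ξ • V) 2 := by
  have hm : Measurable fun ξ => r ξ * (par.memoryFactor ξ * par.weight ξ) :=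
    hr.mul (par.measurable_memoryFactor.mul par.measurable_weight)
  simp only [smul_smul]
  rw [memLp_two_iff_integrable_sq_norm (hm.aestronglyMeasurable.smul_const V)]
  refine (par.integrable_memoryFactor_mul_weight_sq.mul_const (‖V‖ ^ 2)).mono'
    ((hm.aestronglyMeasurable.smul_const V).norm.pow 2) (Eventually.of_forall fun ξ => ?_)
  rw [Real.norm_of_nonneg (sq_nonneg _), norm_smul, mul_pow, Real.norm_eq_abs, sq_abs]
  refine mul_le_mul_of_nonneg_right ?_ (sq_nonneg _)
  calc (r ξ * (par.memoryFactor ξ * par.weight ξ)) ^ 2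
      = r ξ ^ 2 * par.memoryFactor ξ * (par.memoryFactor ξ * par.weight ξ ^ 2) := by ring
    _ ≤ 1 * (par.memoryFactor ξ * par.weight ξ ^ 2) :=
        mul_le_mul_of_nonneg_right (h ξ) (mul_nonneg (par.memoryFactor_pos ξ).le (sq_nonneg _))
    _ = _ := one_mul _

theorem integrable_weight_smul_memoryFactor_smul (f : Lp E 2 (volume : Measure ℝ)) :
    Integrable fun ξ => par.weight ξ • par.memoryFactor ξ • f ξ := by
  have h1 : Integrable fun ξ => ‖f ξ‖ ^ 2 :=
    (memLp_two_iff_integrable_sq_norm (Lp.memLp f).1).1 (Lp.memLp f)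
  refine (par.integrable_memoryFactor_mul_weight_sq.add h1).mono'
    (par.measurable_weight.aestronglyMeasurable.smul
      (par.measurable_memoryFactor.aestronglyMeasurable.smul (Lp.aestronglyMeasurable f)))
    (Eventually.of_forall fun ξ => ?_)
  have hq := par.memoryFactor_pos ξ
  have hq1 := par.memoryFactor_le_one ξ
  rw [smul_smul, norm_smul, Real.norm_eq_abs, abs_mul, abs_of_pos hq, Pi.add_apply,
    ← sq_abs (par.weight ξ)]
  have h2 := mul_nonneg hq.le (sq_nonneg (|par.weight ξ| - ‖f ξ‖))
  have h3 := mul_le_mul_of_nonneg_right hq1 (sq_nonneg ‖f ξ‖)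
  have h4 := mul_nonneg hq.le (mul_nonneg (abs_nonneg (par.weight ξ)) (norm_nonneg (f ξ)))
  nlinarith

theorem integral_memoryFactor_nonneg : 0 ≤ ∫ ξ, par.memoryFactor ξ * par.weight ξ ^ 2 :=
  integral_nonneg fun ξ => mul_nonneg (par.memoryFactor_pos ξ).le (sq_nonneg _)

/-! ### The range condition -/

/-- The system with density `ρ + 𝔠 ∫ μ(ξ)² / (1 + |ξ|² + η) dξ`. Elimination of the memory variable
from the resolvent equation adds this mass to the beam. -/
noncomputable def addedMass : SystemParams :=
  { par with
    ρ := par.ρ + par.fracConst * ∫ ξ, par.memoryFactor ξ * par.weight ξ ^ 2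
    ρ_pos := add_pos_of_pos_of_nonneg par.ρ_pos
      (mul_nonneg par.fracConst_pos.le par.integral_memoryFactor_nonneg) }

open EnergySpace

/-- The range condition. The components `z, V, P` solve the stationary problem for the system with added
mass, in which the memory integral of the data acts as a force on the beam. -/
theorem exists_sub_evolutionOperator_eq (F : par.EnergySpace) :
    ∃ U : par.evolutionOperator.domain, (U : par.EnergySpace) - par.evolutionOperator U = F := by
  set K : ℝ := ∫ ξ, par.memoryFactor ξ * par.weight ξ ^ 2 with hK
  set G : IntervalL2 0 par.ℓ₂ := ∫ ξ, par.weight ξ • par.memoryFactor ξ • F.φ ξ with hG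
  obtain ⟨z, hz, V, hV, P, hP, σ, τ, hσ, hτ, hzw, hσw, hτw, hzV, hσ0, hτ0⟩ :
      ∃ z ∈ SobolevH1L par.neg_ℓ₁_lt_zero, ∃ V ∈ SobolevH1R par.ℓ₂_pos,
      ∃ P ∈ SobolevH1R par.ℓ₂_pos, ∃ σ τ : IntervalL2 0 par.ℓ₂,
        σ = (par.χ : ℂ) • weakDeriv (V + F.v) - ((par.γ * par.β : ℝ) : ℂ) • weakDeriv (P + F.p) ∧
        τ = (par.β : ℂ) • weakDeriv (P + F.p) - ((par.γ * par.β : ℝ) : ℂ) • weakDeriv (V + F.v) ∧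
        HasWeakDeriv ((par.κ : ℂ) • weakDeriv z) (z - F.z) ∧
        HasWeakDeriv σ (((par.ρ + par.fracConst * K : ℝ) : ℂ) • (V -
          ((par.ρ + par.fracConst * K : ℝ) : ℂ)⁻¹ •
            ((par.ρ : ℂ) • F.V - (par.fracConst : ℂ) • G))) ∧
        HasWeakDeriv τ ((par.mag : ℂ) • (P - F.P)) ∧
        pointValue z 0 = pointValue V 0 ∧
        pointValue σ 0 = pointValue ((par.κ : ℂ) • weakDeriv z) 0 ∧ pointValue τ 0 = 0 :=
    par.addedMass.exists_strong_solution F.z ⟨F.v, F.v_mem⟩ _ ⟨F.p, F.p_mem⟩ F.P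
  have l1 : (0 : ℝ) ∈ Icc (-par.ℓ₁) 0 := right_mem_Icc.2 par.neg_ℓ₁_lt_zero.le
  have l2 : (0 : ℝ) ∈ Icc 0 par.ℓ₂ := left_mem_Icc.2 par.ℓ₂_pos.le
  have hκ : (par.κ : ℂ) ≠ 0 := Complex.ofReal_ne_zero.2 par.κ_pos.ne'
  have hβ : (par.β : ℂ) ≠ 0 := Complex.ofReal_ne_zero.2 par.β_pos.ne'
  have hρ : (par.ρ : ℂ) ≠ 0 := Complex.ofReal_ne_zero.2 par.ρ_pos.ne'
  have hmag : (par.mag : ℂ) ≠ 0 := Complex.ofReal_ne_zero.2 par.mag_pos.ne'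
  have hχ : (par.χ₁ : ℂ) ≠ 0 := Complex.ofReal_ne_zero.2 par.χ₁_pos.ne'
  have hρ' : ((par.ρ + par.fracConst * K : ℝ) : ℂ) ≠ 0 :=
    Complex.ofReal_ne_zero.2 par.addedMass.ρ_pos.ne'
  have hv : V + F.v ∈ SobolevH1R par.ℓ₂_pos := add_mem hV F.v_mem
  have hp : P + F.p ∈ SobolevH1R par.ℓ₂_pos := add_mem hP F.p_mem
  -- The constitutive relations are inverted: `χ₁ v_x = σ + γ τ` and `β p_x = τ + γ β v_x`.
  have hvx : weakDeriv (V + F.v) ∈ SobolevH1 0 par.ℓ₂ := by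
    rw [← Submodule.smul_mem_iff _ hχ]
    have : (par.χ₁ : ℂ) • weakDeriv (V + F.v) = σ + (par.γ : ℂ) • τ := by
      rw [hσ, hτ, χ₁]
      push_cast
      module
    rw [this]
    exact add_mem hσw.mem (Submodule.smul_mem _ _ hτw.mem)
  have hpx : weakDeriv (P + F.p) ∈ SobolevH1 0 par.ℓ₂ := by
    rw [← Submodule.smul_mem_iff _ hβ]
    have : (par.β : ℂ) • weakDeriv (P + F.p) =
        τ + ((par.γ * par.β : ℝ) : ℂ) • weakDeriv (V + F.v) := by
      rw [hτ]
      abel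
    rw [this]
    exact add_mem hτw.mem (Submodule.smul_mem _ _ hvx)
  have hzx : weakDeriv z ∈ SobolevH1 (-par.ℓ₁) 0 := (Submodule.smul_mem_iff _ hκ).1 hzw.mem
  have hφ1 := par.memLp_memoryFactor_smul F.φ
  have hφ2 : MemLp (fun ξ => par.memoryFactor ξ • par.weight ξ • V) 2 := by
    simpa using par.memLp_mul_memoryFactor_smul (r := fun _ => 1) measurable_const
      (fun ξ => by simpa using par.memoryFactor_le_one ξ) V
  set Φ := (hφ1.add hφ2).toLp _ with hΦ
  have hΦc : ∀ᵐ ξ, Φ ξ = par.memoryFactor ξ • F.φ ξ + par.memoryFactor ξ • par.weight ξ • V :=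
    (hφ1.add hφ2).coeFn_toLp
  have hmem : ∀ᵐ ξ, -((|ξ| ^ 2 + par.η) • Φ ξ) + par.weight ξ • V = Φ ξ - F.φ ξ := by
    filter_upwards [hΦc] with ξ hξ
    have hq : (1 + |ξ| ^ 2 + par.η) • Φ ξ = F.φ ξ + par.weight ξ • V := by
      rw [hξ, ← smul_add, smul_smul, memoryFactor, mul_inv_cancel₀ (par.one_add_sq_add_pos ξ).ne',
        one_smul]
    have e : (1 + |ξ| ^ 2 + par.η) • Φ ξ = Φ ξ + (|ξ| ^ 2 + par.η) • Φ ξ := by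
      rw [add_assoc, add_smul, one_smul]
    rw [neg_add_eq_sub, sub_eq_sub_iff_add_eq_add, ← e, hq, add_comm]
  have hint : ∫ ξ, par.weight ξ • Φ ξ = G + K • V := by
    rw [hG, hK, ← integral_smul_const, ← integral_add
      (par.integrable_weight_smul_memoryFactor_smul F.φ)
      (par.integrable_memoryFactor_mul_weight_sq.smul_const V)]
    refine integral_congr_ae ?_
    filter_upwards [hΦc] with ξ hξ
    rw [hξ, smul_add, smul_smul (par.memoryFactor ξ), smul_smul (par.weight ξ) (_ * _)]
    congr 2
    ring
  let U : par.EnergySpace := EnergySpace.mk z ⟨V + F.v, hv⟩ V ⟨P + F.p, hp⟩ P Φ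
  have hU : U.InDomain :=
    { z_mem_H1L := hz
      z_mem_H2 := ⟨hz.1, hzx⟩
      v_mem_H1R := hv
      v_mem_H2 := ⟨hv.1, hvx⟩
      p_mem_H1R := hp
      p_mem_H2 := ⟨hp.1, hpx⟩
      V_mem_H1R := hV
      P_mem_H1R := hP
      memLp_abs_smul := by
        refine ((par.memLp_abs_smul_memoryFactor_smul F.φ).add (par.memLp_mul_memoryFactor_smul
          measurable_abs (fun ξ => ?_) V)).ae_eq ?_
        · rw [memoryFactor, ← div_eq_mul_inv, div_le_one (par.one_add_sq_add_pos ξ)]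
          linarith [par.η_nonneg]
        · filter_upwards [hΦc] with ξ hξ
          change _ = |ξ| • Φ ξ
          rw [hξ, smul_add]
          rfl
      memLp_memory := ((Lp.memLp Φ).sub (Lp.memLp F.φ)).ae_eq (by
        filter_upwards [hmem] with ξ hξ
        exact hξ.symm)
      transmission := hzV
      stress := by
        rw [pointValue_smul par.neg_ℓ₁_lt_zero _ hzx l1, hσ, pointValue_sub par.ℓ₂_pos
          (Submodule.smul_mem _ _ hvx) (Submodule.smul_mem _ _ hpx) l2,
          pointValue_smul par.ℓ₂_pos _ hvx l2, pointValue_smul par.ℓ₂_pos _ hpx l2] at hσ0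
        push_cast at hσ0
        exact hσ0
      voltage := by
        rw [hτ, pointValue_sub par.ℓ₂_pos
          (Submodule.smul_mem _ _ hpx) (Submodule.smul_mem _ _ hvx) l2,
          pointValue_smul par.ℓ₂_pos _ hvx l2, pointValue_smul par.ℓ₂_pos _ hpx l2,
          sub_eq_zero] at hτ0
        push_cast at hτ0
        exact hτ0 }
  refine ⟨⟨U, hU⟩, ?_⟩
  change U - evolutionFun U hU = F
  rw [sub_eq_iff_eq_add]
  refine EnergySpace.ext ?_ ?_ ?_ ?_ ?_ ?_
  · rw [add_z, evolutionFun_z, ← IntervalL2.ofReal_smul]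
    change z = F.z + (par.κ : ℂ) • weakDeriv (weakDeriv z)
    rw [← weakDeriv_smul _ hzx, hzw.weakDeriv_eq]
    abel
  · rw [add_v, evolutionFun_v]
    exact add_comm _ _
  -- The added mass `𝔠 K` in the equation for `σ` cancels the part `𝔠 K V` of the memory integral.
  · rw [add_V, evolutionFun_V]
    change V = F.V + (1 / par.ρ) • (par.χ • weakDeriv (weakDeriv (V + F.v))
      - (par.γ * par.β) • weakDeriv (weakDeriv (P + F.p))
      - par.fracConst • ∫ ξ : ℝ, par.weight ξ • Φ ξ)
    have e := hσw.weakDeriv_eq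
    rw [hσ, weakDeriv_sub (Submodule.smul_mem _ _ hvx) (Submodule.smul_mem _ _ hpx),
      weakDeriv_smul _ hvx, weakDeriv_smul _ hpx, smul_sub, smul_inv_smul₀ hρ'] at e
    rw [hint]
    simp only [← IntervalL2.ofReal_smul]
    rw [e]
    push_cast
    match_scalars <;> field_simp <;> ring
  · rw [add_p, evolutionFun_p]
    exact add_comm _ _
  · rw [add_P, evolutionFun_P]
    change P = F.P + (1 / par.mag) • (par.β • weakDeriv (weakDeriv (P + F.p))
      - (par.γ * par.β) • weakDeriv (weakDeriv (V + F.v)))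
    have e := hτw.weakDeriv_eq
    rw [hτ, weakDeriv_sub (Submodule.smul_mem _ _ hpx) (Submodule.smul_mem _ _ hvx),
      weakDeriv_smul _ hvx, weakDeriv_smul _ hpx] at e
    simp only [← IntervalL2.ofReal_smul]
    rw [e, Complex.ofReal_div, Complex.ofReal_one, one_div, inv_smul_smul₀ hmag]
    abel
  · rw [add_φ, evolutionFun_φ]
    refine Lp.ext ?_
    filter_upwards [Lp.coeFn_add F.φ (hU.memLp_memory.toLp _), hU.memLp_memory.coeFn_toLp, hmem]
      with ξ h1 h2 h3
    rw [h1, Pi.add_apply, h2]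
    change Φ ξ = F.φ ξ + (-((|ξ| ^ 2 + par.η) • Φ ξ) + par.weight ξ • V)
    rw [h3]
    abel

end SystemParams

theorem mainTheorem4 (par : SystemParams) :
    ∃ S : C0Semigroup par.EnergySpace, S.IsContraction ∧ S.IsGenerator par.evolutionOperator :=
  par.isDissipative_evolutionOperator.exists_c0Semigroup par.exists_sub_evolutionOperator_eq
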